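/- **Proposition.** Let $\mathcal M$ be a combinatorial model category (i.e. locally presentable as a category, and cofibrantly generated as a model category) in which every object is fibrant, and let $K$ be a set of objects of $\mathcal M$. For objects $X, Y$ let $\mathrm{map}(X,Y)=\mathcal M(\tilde X,\hat Y_\bullet)$ denote the right homotopy function complex, where $\tilde X\to X$ is a cofibrant approximation (a weak equivalence with $\tilde X$ cofibrant) and $\hat Y_\bullet$ is a simplicial resolution of $Y$ (a Reedy fibrant simplicial object with a levelwise weak equivalence from the constant simplicial object at $Y$). A map $f$ is a *$K$-colocal equivalence* if $\mathrm{map}(X,f)$, computed with a cofibrant approximation to $X$ and a map of simplicial resolutions extending $f$, is a weak equivalence of simplicial sets for all $X\in K$ (this does not depend on the choices). Then the right Bousfield localization $R_K\mathcal M$ exists: there is a model structure on the underlying category of $\mathcal M$ whose weak equivalences are the $K$-colocal equivalences and whose fibrations are the fibrations of $\mathcal M$. It is combinatorial, and every object is fibrant in it. Moreover, every $A\in K$ has a cosimplicial resolution (a Reedy cofibrant cosimplicial object with a levelwise weak equivalence to the constant cosimplicial object at $A$), and for every choice of a cosimplicial resolution $A^\bullet$ of each $A\in K$ and every set $J$ of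 generating trivial cofibrations of $\mathcal M$, the model category $R_K\mathcal M$ is cofibrantly generated with generating cofibrations $\Lambda(K)\cup J$, where $$\Lambda(K)=\bigl\{A^\bullet\otimes\partial\Delta[n]\to A^\bullet\otimes\Delta[n] : A\in K,\ n\ge 0\bigr\},$$ and with generating trivial cofibrations $J$. Here $A^\bullet\otimes L$, for a simplicial set $L$, is the colimit of $A^m$ over the category of simplices $\Delta[m]\to L$ of $L$. -/

import Mathlib

universe w u

open CategoryTheory Limits HomotopicalAlgebra Opposite Simplicial

namespace RightBousfield

noncomputable section

/-! ### Weak equivalences of simplicial sets -/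

/-- Homotopy classes of maps of simplicial sets: the quotient of `X ⟶ Z` by the equivalence
relation generated by simplicial homotopy. -/
def HomotopyClasses (X Z : SSet.{w}) : Type w :=
  Quot (fun a b : X ⟶ Z ↦ Nonempty (SSet.Homotopy a b))

/-- Precomposition with `f` on homotopy classes. -/
def HomotopyClasses.precomp {X Y : SSet.{w}} (f : X ⟶ Y) (Z : SSet.{w}) :
    HomotopyClasses Y Z → HomotopyClasses X Z :=
  Quot.map (fun a ↦ f ≫ a) (fun _ _ ⟨H⟩ ↦
    ⟨SSet.RelativeMorphism.Homotopy.precomp H (SSet.RelativeMorphism.botEquiv.symm f)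
      (SSet.Subcomplex.isInitialBot.hom_ext _ _)⟩)

/-- A weak homotopy equivalence of simplicial sets: for every Kan complex `Z`, precomposition
with `f` is a bijection `[Y, Z] → [X, Z]` on homotopy classes of maps. -/
def IsWeakHomotopyEquivalence {X Y : SSet.{w}} (f : X ⟶ Y) : Prop :=
  ∀ (Z : SSet.{w}), SSet.KanComplex Z → Function.Bijective (HomotopyClasses.precomp f Z)

variable {C : Type u} [Category.{w} C]

/-! ### Tensoring a cosimplicial object, and cotensoring a simplicial object, with a
simplicial set

`CostructuredArrow simplexFunctor K` is the category of simplices of `K`: its objects are the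
maps `Δ[n] ⟶ K`. -/

/-- The functor `[n] ↦ Δ[n]`. -/
abbrev simplexFunctor : SimplexCategory ⥤ SSet.{w} := SSet.stdSimplex

instance [HasColimits C] (K : SSet.{w}) :
    HasColimitsOfShape (CostructuredArrow simplexFunctor.{w} K) C :=
  (hasColimitsOfSizeShrink.{0, w, w, w} C).has_colimits_of_shape _

instance [HasLimits C] (K : SSet.{w}) :
    HasLimitsOfShape (CostructuredArrow simplexFunctor.{w} K)ᵒᵖ C :=
  (hasLimitsOfSizeShrink.{0, w, w, w} C).has_limits_of_shape _

/-- The map `[m] ⟶ [n]` which corresponds to a simplex `Δ[m] ⟶ ∂Δ[n]`. -/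
def boundaryHom {n : ℕ} (σ : CostructuredArrow simplexFunctor.{w} (∂Δ[n] : SSet.{w})) :
    σ.left ⟶ ⦋n⦌ :=
  SSet.stdSimplex.fullyFaithful.preimage (σ.hom ≫ (SSet.boundary n).ι)

lemma comp_boundaryHom {n : ℕ}
    {σ τ : CostructuredArrow simplexFunctor.{w} (∂Δ[n] : SSet.{w})} (g : σ ⟶ τ) :
    g.left ≫ boundaryHom τ = boundaryHom σ := by
  apply SSet.stdSimplex.{w}.map_injective
  refine (Functor.map_comp _ _ _).trans ?_
  refine (congrArg (SSet.stdSimplex.{w}.map g.left ≫ ·)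
    (SSet.stdSimplex.fullyFaithful.map_preimage _)).trans ?_
  refine Eq.trans ?_ (SSet.stdSimplex.fullyFaithful.map_preimage _).symm
  exact (Category.assoc _ _ _).symm.trans
    (congrArg (· ≫ (SSet.boundary n).ι) (CostructuredArrow.w g))

section

variable [HasColimits C] (A : SimplexCategory ⥤ C)

/-- `A ⊗ K`, the colimit of `A⁽ᵐ⁾` over all simplices `Δ[m] ⟶ K`. -/
def tensorObj (K : SSet.{w}) : C :=
  colimit (CostructuredArrow.proj simplexFunctor.{w} K ⋙ A)

/-- The functoriality `A ⊗ K ⟶ A ⊗ L` for `f : K ⟶ L`. -/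
def tensorMap {K L : SSet.{w}} (f : K ⟶ L) : tensorObj A K ⟶ tensorObj A L :=
  colimit.pre (CostructuredArrow.proj simplexFunctor.{w} L ⋙ A) (CostructuredArrow.map f)

/-- The latching map `A ⊗ ∂Δ[n] ⟶ A⁽ⁿ⁾`. -/
def latchingMap (n : ℕ) : tensorObj A (∂Δ[n] : SSet.{w}) ⟶ A.obj ⦋n⦌ :=
  colimit.desc (CostructuredArrow.proj simplexFunctor.{w} (∂Δ[n] : SSet.{w}) ⋙ A)
    { pt := A.obj ⦋n⦌
      ι :=
        { app := fun σ ↦ A.map (boundaryHom σ)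
          naturality := fun _ _ g ↦
            ((A.map_comp _ _).symm.trans (congrArg A.map (comp_boundaryHom g))).trans
              (Category.comp_id _).symm } }

end

section

variable [HasLimits C] (Y : SimplexCategoryᵒᵖ ⥤ C)

/-- `Y ^ K`, the limit of `Y_m` over all simplices `Δ[m] ⟶ K`. -/
def cotensorObj (K : SSet.{w}) : C :=
  limit ((CostructuredArrow.proj simplexFunctor.{w} K).op ⋙ Y)

/-- The matching map `Y_n ⟶ Y ^ ∂Δ[n]`. -/
def matchingMap (n : ℕ) : Y.obj (op ⦋n⦌) ⟶ cotensorObj Y (∂Δ[n] : SSet.{w}) :=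
  limit.lift ((CostructuredArrow.proj simplexFunctor.{w} (∂Δ[n] : SSet.{w})).op ⋙ Y)
    { pt := Y.obj (op ⦋n⦌)
      π :=
        { app := fun σ ↦ Y.map (boundaryHom σ.unop).op
          naturality := fun σ _ g ↦
            (Category.id_comp _).trans
              ((congrArg (fun h ↦ Y.map h.op) (comp_boundaryHom g.unop)).symm.trans
                (Y.map_comp (boundaryHom σ.unop).op g.unop.left.op)) } }

end

/-! ### Resolutions and homotopy function complexes -/

/-- A cosimplicial resolution of `A`: a Reedy cofibrant cosimplicial object with a levelwise
weak equivalence to the constant cosimplicial object at `A`. -/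
structure CosimplicialResolution [HasColimits C] (M : ModelCategory C) (A : C) where
  obj : SimplexCategory ⥤ C
  π : obj ⟶ (Functor.const SimplexCategory).obj A
  weakEquivalence : ∀ m : SimplexCategory, WeakEquivalence (π.app m)
  reedyCofibrant : ∀ n : ℕ, Cofibration (latchingMap obj n)

/-- A simplicial resolution of `Y`: a Reedy fibrant simplicial object with a levelwise
weak equivalence from the constant simplicial object at `Y`. -/
structure SimplicialResolution [HasLimits C] (M : ModelCategory C) (Y : C) where
  obj : SimplexCategoryᵒᵖ ⥤ C
  ι : (Functor.const SimplexCategoryᵒᵖ).obj Y ⟶ obj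
  weakEquivalence : ∀ m : SimplexCategoryᵒᵖ, WeakEquivalence (ι.app m)
  reedyFibrant : ∀ n : ℕ, Fibration (matchingMap obj n)

/-- A simplicial resolution of a map `f`: a map between simplicial resolutions of its source
and target which extends `f`. -/
structure SimplicialResolutionHom [HasLimits C] (M : ModelCategory C) {A B : C} (f : A ⟶ B) where
  source : SimplicialResolution M A
  target : SimplicialResolution M B
  hom : source.obj ⟶ target.obj
  comm : source.ι ≫ hom = (Functor.const SimplexCategoryᵒᵖ).map f ≫ target.ι

/-- A cofibrant approximation to `X`. -/
structure CofibrantApproximation (M : ModelCategory C) (X : C) where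
  obj : C
  π : obj ⟶ X
  cofibrant : IsCofibrant obj
  weakEquivalence : WeakEquivalence π

/-- The simplicial set `C(X, Y_•)`. It is the right homotopy function complex `map(X', Y')` when
`X` is a cofibrant approximation to `X'` and `Y` is a simplicial resolution of `Y'`. -/
def homComplex (X : C) (Y : SimplexCategoryᵒᵖ ⥤ C) : SSet.{w} :=
  Y ⋙ coyoneda.obj (op X)

/-- The map `C(X, Y_•) ⟶ C(X, Y'_•)` induced by `g : Y ⟶ Y'`. -/
def homComplexMap (X : C) {Y Y' : SimplexCategoryᵒᵖ ⥤ C} (g : Y ⟶ Y') :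
    homComplex X Y ⟶ homComplex X Y' :=
  Functor.whiskerRight g (coyoneda.obj (op X))

/-! ### Right Bousfield localization -/

/-- The `K`-colocal equivalences: the maps `f` such that `map(X, f)` is a weak equivalence of
simplicial sets for all `X` in `K`, where `map` is the right homotopy function complex, computed
by a cofibrant approximation to `X` and a simplicial resolution of `f`. (Whether `map(X, f)` is a
weak equivalence does not depend on these choices.) -/
def colocalEquivalences [HasLimits C] (M : ModelCategory C) (K : ObjectProperty C) :
    MorphismProperty C :=
  fun _ _ f ↦ ∀ X : C, K X → ∃ (X' : CofibrantApproximation M X)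
    (r : SimplicialResolutionHom M f), IsWeakHomotopyEquivalence (homComplexMap X'.obj r.hom)

/-- The model structure `R` is the right Bousfield localization of the model structure `M`
with respect to `K`: its weak equivalences are the `K`-colocal equivalences of `M` and its
fibrations are the fibrations of `M`. -/
structure IsRightBousfieldLocalization [HasLimits C] (M : ModelCategory C) (K : ObjectProperty C)
    (R : ModelCategory C) : Prop where
  weakEquivalences_eq :
    R.categoryWithWeakEquivalences.weakEquivalences = colocalEquivalences M K
  fibrations_eq :
    R.categoryWithFibrations.fibrations = M.categoryWithFibrations.fibrations

/-- The model structure `M` is cofibrantly generated, with `I` a set of generating cofibrations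
and `J` a set of generating trivial cofibrations. (The smallness of the sets `I` and `J` is part
of `HasSmallObjectArgument`.) -/
structure IsCofibrantlyGeneratedBy (M : ModelCategory C) (I J : MorphismProperty C) : Prop where
  smallObjectArgument_I : MorphismProperty.HasSmallObjectArgument.{w} I
  smallObjectArgument_J : MorphismProperty.HasSmallObjectArgument.{w} J
  rlp_I : I.rlp = trivialFibrations C
  rlp_J : J.rlp = fibrations C

/-- A model category is combinatorial if it is locally presentable as a category and cofibrantly
generated as a model category. -/
structure IsCombinatorial (M : ModelCategory C) : Prop where
  isLocallyPresentable : IsLocallyPresentable.{w} C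
  exists_generators : ∃ I J : MorphismProperty C, IsCofibrantlyGeneratedBy M I J

/-- Every object is fibrant for the model structure `M`. -/
def AllObjectsFibrant (M : ModelCategory C) : Prop :=
  ∀ X : C, IsFibrant X

/-- `Λ(K)`, the maps `A^• ⊗ ∂Δ[n] ⟶ A^• ⊗ Δ[n]` for `A` in `K` and `n ≥ 0`, where `A^•` is the
cosimplicial resolution of `A` chosen by `res`. -/
def Lambda [HasColimits C] {M : ModelCategory C} (K : ObjectProperty C)
    (res : ∀ A : C, K A → CosimplicialResolution M A) : MorphismProperty C :=
  MorphismProperty.ofHoms (fun i : Subtype K × ℕ ↦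
    tensorMap (res i.1.1 i.1.2).obj (SSet.boundary.{w} i.2).ι)

end

end RightBousfield

/-! Since every object is fibrant, a cosimplicial resolution `A^•` of `A` gives a model `C(A^•, Y)`
of `map(A, Y)` which needs no resolution of `Y`. Once this is known (`colocalEquivalences_iff`), the
colocal equivalences are the maps sent to weak homotopy equivalences by the functors `singular A^•`
for `A` in `K`, and two out of three becomes immediate.

These functors send fibrations to Kan fibrations between Kan complexes, and such a Kan fibration is
a weak homotopy equivalence exactly when it lifts against all `∂Δ[n] ⟶ Δ[n]`. By the adjunction
`tensorAdj`, a fibration is therefore a colocal equivalence exactly when it lifts against `Λ(K)`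
(`rlp_Lambda_sup`). Trivial cofibrations of `M` are colocal equivalences by Ken Brown's argument, so
the recognition theorem `exists_modelCategory` applies to `Λ(K) ∪ J` and `J`.

The long part is the comparison of the two function complexes. Up to weak equivalence, a map of
simplicial resolutions is a Reedy fibration `p`. Then `map(X, p)` is a weak equivalence iff a
cofibrant approximation of `X` lifts against every relative matching map of `p`, while `C(A^•, p_0)`
is one iff every latching map of `A^•` lifts against `p_0`. The exchange lemma
`hasLiftingProperty_latching_succ_iff` trades one degree of the latching map for one degree of the
relative matching map; iterating it moves the degrees `(n, 0)` to `(0, n)`.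

Simplicial objects `Y` of `C` are handled as cosimplicial objects of `Cᵒᵖ`, through the left adjoint
`tensorFunctor Y.rightOp : SSet ⥤ Cᵒᵖ`; one theory of left adjoints on simplicial sets thus covers
latching and matching maps. Resolutions and Reedy factorizations come from the small object
argument. -/

namespace RightBousfield

noncomputable section

/-! ### Weak homotopy equivalences and Kan fibrations -/

section SSetHomotopy

open MonoidalCategory CartesianMonoidalCategory SSet.modelCategoryQuillen

/-- The inclusion `X ⟶ X ⊗ Δ[1]` at the vertex `e` of `Δ[1]`. -/
def endpointInclusion (X : SSet.{w}) (e : Fin 2) : X ⟶ X ⊗ Δ[1] :=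
  lift (𝟙 X) (SSet.const (SSet.stdSimplex.obj₀Equiv.{w}.symm e))

lemma endpointInclusion_whiskerRight_assoc {X Y Z : SSet.{w}} (f : X ⟶ Y) (e : Fin 2)
    (g : Y ⊗ Δ[1] ⟶ Z) :
    endpointInclusion X e ≫ f ▷ _ ≫ g = f ≫ endpointInclusion Y e ≫ g := rfl

lemma horn_one_ι (e : Fin 2) :
    (SSet.horn.{w} 1 e).ι = SSet.const (SSet.stdSimplex.obj₀Equiv.{w}.symm e) := by
  ext m x
  induction m using Opposite.rec with | _ m
  induction m using SimplexCategory.rec with | _ m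
  obtain ⟨x, hx⟩ := x
  rw [SSet.mem_horn_iff_notMem_range] at hx
  obtain ⟨j, hj, hx⟩ := hx
  apply SSet.stdSimplex.ext
  intro i
  change x i = e
  have : x i ≠ j := fun h ↦ hx ⟨i, h⟩
  lia

/-- The relative homotopy lifting property of Kan fibrations. -/
lemma exists_homotopy_lift {L E B : SSet.{w}} (S : L.Subcomplex) (p : E ⟶ B) [Fibration p]
    (e : Fin 2) (V : L ⊗ Δ[1] ⟶ B) (U : (S : SSet.{w}) ⊗ Δ[1] ⟶ E) (x : L ⟶ E)
    (hUV : S.ι ▷ _ ≫ V = U ≫ p) (hV : endpointInclusion L e ≫ V = x ≫ p)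
    (hU : S.ι ≫ x = endpointInclusion _ e ≫ U) :
    ∃ W : L ⊗ Δ[1] ⟶ E, W ≫ p = V ∧ S.ι ▷ _ ≫ W = U ∧ endpointInclusion L e ≫ W = x := by
  have aux (X : SSet.{w}) :
      X ◁ (SSet.horn.{w} 1 e).ι = fst _ _ ≫ endpointInclusion X e := by
    rw [horn_one_ι]; rfl
  have hp : (fibrations SSet.{w}) p := (HomotopicalAlgebra.fibration_iff p).1 inferInstance
  -- The horn `Λ[1, e]` is the vertex `e`, so `U` and `x` together are a map on `S ⊗ Δ[1] ∪ L ⊗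
  -- {e}`, whose inclusion into `L ⊗ Δ[1]` is anodyne.
  have hlift := SSet.anodyneExtensions_unionProd_ι S (SSet.horn.{w} 1 e)
    (SSet.anodyneExtensions.horn_ι e) p hp
  have hpo := SSet.Subcomplex.unionProd.isPushout S (SSet.horn.{w} 1 e)
  have w₁ : S.ι ▷ (SSet.horn.{w} 1 e : SSet.{w}) ≫ fst _ _ ≫ x =
      (S : SSet.{w}) ◁ (SSet.horn.{w} 1 e).ι ≫ U := by
    rw [aux, Category.assoc, ← hU]; rfl
  have sq : CommSq (hpo.desc (fst _ _ ≫ x) U w₁)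
      (S.unionProd (SSet.horn.{w} 1 e)).ι p V := ⟨by
    apply hpo.hom_ext
    · rw [hpo.inl_desc_assoc, SSet.Subcomplex.unionProd.ι₁_ι_assoc, aux, Category.assoc,
        Category.assoc, hV]
    · rw [hpo.inr_desc_assoc, SSet.Subcomplex.unionProd.ι₂_ι_assoc, hUV]⟩
  refine ⟨sq.lift, sq.fac_right, ?_, ?_⟩
  · rw [← SSet.Subcomplex.unionProd.ι₂_ι_assoc S (SSet.horn.{w} 1 e), sq.fac_left, hpo.inr_desc]
  · have hT : SSet.Subcomplex.range (SSet.const (X := L)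
        (SSet.stdSimplex.obj₀Equiv.{w}.symm e)) ≤ SSet.horn.{w} 1 e := by
      rintro m _ ⟨y, rfl⟩
      induction m using Opposite.rec with | _ m
      induction m using SimplexCategory.rec with | _ m
      rw [SSet.mem_horn_iff_notMem_range]
      -- Simplices constant at `e` miss the other vertex, `1 - e`.
      refine ⟨1 - e, by lia, ?_⟩
      rintro ⟨i, hi⟩
      change e = 1 - e at hi
      lia
    let t : L ⟶ L ⊗ (SSet.horn.{w} 1 e : SSet.{w}) :=
      lift (𝟙 L) (SSet.Subcomplex.lift _ hT)
    have ht : t ≫ L ◁ (SSet.horn.{w} 1 e).ι = endpointInclusion L e := rfl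
    rw [← ht, Category.assoc, ← SSet.Subcomplex.unionProd.ι₁_ι_assoc S (SSet.horn.{w} 1 e),
      sq.fac_left, hpo.inl_desc]
    rfl

lemma nonempty_homotopy_iff {X Z : SSet.{w}} (a b : X ⟶ Z) :
    Nonempty (SSet.Homotopy a b) ↔ ∃ H : X ⊗ Δ[1] ⟶ Z,
      endpointInclusion X 0 ≫ H = a ∧ endpointInclusion X 1 ≫ H = b := by
  constructor
  · rintro ⟨H⟩
    exact ⟨H.h, H.h₀, H.h₁⟩
  · rintro ⟨H, h₀, h₁⟩
    have e : (⊥ : X.Subcomplex).ι ▷ Δ[1] ≫ H =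
        fst _ _ ≫ SSet.Subcomplex.isInitialBot.to (⊥ : Z.Subcomplex) ≫ (⊥ : Z.Subcomplex).ι := by
      ext m x
      exact x.1.2.elim
    exact ⟨{ h := H, h₀ := h₀, h₁ := h₁, rel := e }⟩

lemma HomotopyClasses.mk_postcomp {X Z Z' : SSet.{w}} (g : Z ⟶ Z') {a b : X ⟶ Z}
    (h : (Quot.mk _ a : HomotopyClasses X Z) = Quot.mk _ b) :
    (Quot.mk _ (a ≫ g) : HomotopyClasses X Z') = Quot.mk _ (b ≫ g) := by
  have := Quot.eqvGen_exact h
  clear h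
  induction this with
  | rel a b h =>
    obtain ⟨H, h₀, h₁⟩ := (nonempty_homotopy_iff _ _).1 h
    exact Quot.sound ((nonempty_homotopy_iff _ _).2
      ⟨H ≫ g, by rw [← h₀, Category.assoc], by rw [← h₁, Category.assoc]⟩)
  | refl => rfl
  | symm _ _ _ ih => exact ih.symm
  | trans _ _ _ _ _ ih₁ ih₂ => exact ih₁.trans ih₂

lemma HomotopyClasses.precomp_comp {X Y Z : SSet.{w}} (f : X ⟶ Y) (g : Y ⟶ Z) (T : SSet.{w}) :
    precomp (f ≫ g) T = precomp f T ∘ precomp g T := by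
  funext x
  induction x using Quot.ind with | _ x
  exact congrArg (Quot.mk _) (Category.assoc _ _ _)

lemma HomotopyClasses.precomp_id (X T : SSet.{w}) : precomp (𝟙 X) T = id := by
  funext x
  induction x using Quot.ind with | _ x
  exact congrArg (Quot.mk _) (Category.id_comp _)

/-- The weak homotopy equivalences, as a class of morphisms. -/
def weakHomotopyEquivalences : MorphismProperty SSet.{w} :=
  fun _ _ f ↦ IsWeakHomotopyEquivalence f

instance : weakHomotopyEquivalences.{w}.HasTwoOutOfThreeProperty where
  comp_mem f g hf hg Z hZ := by
    rw [HomotopyClasses.precomp_comp]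
    exact (hf Z hZ).comp (hg Z hZ)
  of_postcomp f g hg hfg Z hZ := by
    have := hfg Z hZ
    rw [HomotopyClasses.precomp_comp] at this
    exact (Function.Bijective.of_comp_iff _ (hg Z hZ)).1 this
  of_precomp f g hf hfg Z hZ := by
    have := hfg Z hZ
    rw [HomotopyClasses.precomp_comp] at this
    exact (Function.Bijective.of_comp_iff' (hf Z hZ) _).1 this

instance : weakHomotopyEquivalences.{w}.ContainsIdentities where
  id_mem X Z _ := by
    rw [HomotopyClasses.precomp_id]
    exact Function.bijective_id

lemma isWeakHomotopyEquivalence_of_isIso {X Y : SSet.{w}} (f : X ⟶ Y) [IsIso f] :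
    IsWeakHomotopyEquivalence f := fun Z _ ↦ by
  refine Function.bijective_iff_has_inverse.2 ⟨HomotopyClasses.precomp (inv f) Z, fun x ↦ ?_,
    fun x ↦ ?_⟩
  · rw [← Function.comp_apply (f := HomotopyClasses.precomp (inv f) Z),
      ← HomotopyClasses.precomp_comp, IsIso.inv_hom_id, HomotopyClasses.precomp_id, id]
  · rw [← Function.comp_apply (f := HomotopyClasses.precomp f Z),
      ← HomotopyClasses.precomp_comp, IsIso.hom_inv_id, HomotopyClasses.precomp_id, id]

instance : weakHomotopyEquivalences.{w}.RespectsIso :=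
  MorphismProperty.RespectsIso.of_respects_arrow_iso _ (fun f g e hf ↦ by
    have : weakHomotopyEquivalences (e.hom.left ≫ g.hom) := by
      rw [Arrow.w]
      exact weakHomotopyEquivalences.comp_mem _ _ hf (isWeakHomotopyEquivalence_of_isIso _)
    exact weakHomotopyEquivalences.of_precomp (W' := weakHomotopyEquivalences) _ _
      (isWeakHomotopyEquivalence_of_isIso _) this)

/-- Two maps can be extended to a homotopy along a trivial Kan fibration. -/
lemma exists_homotopy_of_rlp {X E B : SSet.{w}} {q : E ⟶ B} (hq : I.rlp q) (a b : X ⟶ E)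
    (h : a ≫ q = b ≫ q) : Nonempty (SSet.Homotopy a b) := by
  rw [nonempty_homotopy_iff]
  rw [← SSet.rlp_monomorphisms] at hq
  -- The union `R 0 ⊔ R 1` is `X ⊗ ∂Δ[1]`. The homotopy is a lift of the constant homotopy at `a ≫
  -- q` with prescribed ends `a` and `b`.
  let R (e : Fin 2) := SSet.Subcomplex.range (endpointInclusion X e)
  have hR : SSet.Subcomplex.BicartSq ⊥ (R 0) (R 1) (R 0 ⊔ R 1) :=
    { sup_eq := rfl
      inf_eq := by
        rw [eq_bot_iff]
        rintro ⟨m⟩ _ ⟨⟨x, rfl⟩, ⟨y, hy⟩⟩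
        induction m using SimplexCategory.rec with | _ m
        have := DFunLike.congr_fun (congrArg Prod.snd hy) (0 : Fin (m + 1))
        change (1 : Fin 2) = 0 at this
        simp at this }
  have hpo := hR.isPushout
  let φ := hpo.desc ((R 0).ι ≫ fst _ _ ≫ a) ((R 1).ι ≫ fst _ _ ≫ b)
    (SSet.Subcomplex.isInitialBot.hom_ext _ _)
  have := hq (R 0 ⊔ R 1).ι inferInstance
  have sq : CommSq φ (R 0 ⊔ R 1).ι q (fst _ _ ≫ a ≫ q) := ⟨by
    apply hpo.hom_ext
    · rw [hpo.inl_desc_assoc]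
      simp only [Category.assoc]
      rfl
    · rw [hpo.inr_desc_assoc]
      simp only [Category.assoc, h]
      rfl⟩
  refine ⟨sq.lift, ?_, ?_⟩
  · have : endpointInclusion X 0 = SSet.Subcomplex.toRange (endpointInclusion X 0) ≫
      SSet.Subcomplex.homOfLE le_sup_left ≫ (R 0 ⊔ R 1).ι := rfl
    rw [this, Category.assoc, Category.assoc, sq.fac_left, hpo.inl_desc]
    rfl
  · have : endpointInclusion X 1 = SSet.Subcomplex.toRange (endpointInclusion X 1) ≫
      SSet.Subcomplex.homOfLE le_sup_right ≫ (R 0 ⊔ R 1).ι := rfl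
    rw [this, Category.assoc, Category.assoc, sq.fac_left, hpo.inr_desc]
    rfl

/-- Lifting against `∅ ⟶ B` gives a section `s`; since `q ≫ s` and `𝟙 E` agree after `q`, they are
homotopic, so `q` is a homotopy equivalence. -/
lemma isWeakHomotopyEquivalence_of_rlp {E B : SSet.{w}} {q : E ⟶ B} (hq : I.rlp q) :
    IsWeakHomotopyEquivalence q := by
  obtain ⟨s, hs⟩ : ∃ s : B ⟶ E, s ≫ q = 𝟙 B := by
    have hq' := hq
    rw [← SSet.rlp_monomorphisms] at hq'
    have := hq' (⊥ : B.Subcomplex).ι inferInstance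
    have sq : CommSq (SSet.Subcomplex.isInitialBot.to E) (⊥ : B.Subcomplex).ι q (𝟙 B) :=
      ⟨SSet.Subcomplex.isInitialBot.hom_ext _ _⟩
    exact ⟨sq.lift, sq.fac_right⟩
  obtain ⟨H⟩ := exists_homotopy_of_rlp hq (q ≫ s) (𝟙 E) (by simp [hs])
  intro Z _
  refine Function.bijective_iff_has_inverse.2 ⟨HomotopyClasses.precomp s Z, fun x ↦ ?_,
    fun x ↦ ?_⟩
  · rw [← Function.comp_apply (f := HomotopyClasses.precomp s Z),
      ← HomotopyClasses.precomp_comp, hs, HomotopyClasses.precomp_id, id]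
  · rw [← Function.comp_apply (f := HomotopyClasses.precomp q Z),
      ← HomotopyClasses.precomp_comp]
    induction x using Quot.ind with | _ x
    have := HomotopyClasses.mk_postcomp x (Quot.sound ⟨H⟩)
    rw [Category.id_comp] at this
    exact this

/-- A section of a Kan fibration up to homotopy can be replaced by a section. -/
lemma exists_section_of_homotopy {E B : SSet.{w}} (q : E ⟶ B) [Fibration q] (b : B ⟶ B)
    (h : Relation.EqvGen (fun a b : B ⟶ B ↦ Nonempty (SSet.Homotopy a b)) b (𝟙 B))
    (s : B ⟶ E) (hs : s ≫ q = b) :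
    ∃ s' : B ⟶ E, s' ≫ q = 𝟙 B ∧
      (Quot.mk _ s : HomotopyClasses B E) = Quot.mk _ s' := by
  -- As `B` is not assumed to be Kan, homotopy need not be an equivalence relation. The induction
  -- runs over zigzags of homotopies and has to carry both directions.
  suffices ∀ b b' : B ⟶ B,
      Relation.EqvGen (fun a b : B ⟶ B ↦ Nonempty (SSet.Homotopy a b)) b b' →
      ((∀ s : B ⟶ E, s ≫ q = b → ∃ s' : B ⟶ E, s' ≫ q = b' ∧
        (Quot.mk _ s : HomotopyClasses B E) = Quot.mk _ s') ∧
      (∀ s : B ⟶ E, s ≫ q = b' → ∃ s' : B ⟶ E, s' ≫ q = b ∧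
        (Quot.mk _ s : HomotopyClasses B E) = Quot.mk _ s')) from
    (this b (𝟙 B) h).1 s hs
  intro b b' h
  induction h with
  | rel b b' h =>
    obtain ⟨H, h₀, h₁⟩ := (nonempty_homotopy_iff _ _).1 h
    have key (e : Fin 2) (s : B ⟶ E) (hs : endpointInclusion B e ≫ H = s ≫ q) :
        ∃ W : B ⊗ Δ[1] ⟶ E, W ≫ q = H ∧ endpointInclusion B e ≫ W = s := by
      obtain ⟨W, h₁, -, h₂⟩ := exists_homotopy_lift (⊥ : B.Subcomplex) q e H
        { app m := ↾(fun x ↦ x.1.2.elim)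
          naturality _ _ _ := by ext x; exact x.1.2.elim } s
        (by ext m x; exact x.1.2.elim) hs (SSet.Subcomplex.isInitialBot.hom_ext _ _)
      exact ⟨W, h₁, h₂⟩
    constructor
    · intro s hs
      obtain ⟨W, hW, hW'⟩ := key 0 s (by rw [h₀, hs])
      exact ⟨endpointInclusion B 1 ≫ W, by rw [Category.assoc, hW, h₁],
        Quot.sound ((nonempty_homotopy_iff _ _).2 ⟨W, hW', rfl⟩)⟩
    · intro s hs
      obtain ⟨W, hW, hW'⟩ := key 1 s (by rw [h₁, hs])
      exact ⟨endpointInclusion B 0 ≫ W, by rw [Category.assoc, hW, h₀],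
        (Quot.sound ((nonempty_homotopy_iff _ _).2 ⟨W, rfl, hW'⟩)).symm⟩
  | refl b => exact ⟨fun s hs ↦ ⟨s, hs, rfl⟩, fun s hs ↦ ⟨s, hs, rfl⟩⟩
  | symm _ _ _ ih => exact ⟨ih.2, ih.1⟩
  | trans _ _ _ _ _ ih₁ ih₂ =>
    constructor
    · intro s hs
      obtain ⟨s₁, hs₁, e₁⟩ := ih₁.1 s hs
      obtain ⟨s₂, hs₂, e₂⟩ := ih₂.1 s₁ hs₁
      exact ⟨s₂, hs₂, e₁.trans e₂⟩
    · intro s hs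
      obtain ⟨s₁, hs₁, e₁⟩ := ih₂.2 s hs
      obtain ⟨s₂, hs₂, e₂⟩ := ih₁.2 s₁ hs₁
      exact ⟨s₂, hs₂, e₁.trans e₂⟩

/-- A Kan fibration between Kan complexes which is a weak homotopy equivalence is a
trivial Kan fibration. -/
lemma rlp_of_isWeakHomotopyEquivalence {E B : SSet.{w}} (q : E ⟶ B) [Fibration q]
    (hE : SSet.KanComplex E) (hB : SSet.KanComplex B) (hq : IsWeakHomotopyEquivalence q) :
    I.rlp q := by
  obtain ⟨s, hs⟩ : ∃ s : B ⟶ E, (Quot.mk _ (q ≫ s) : HomotopyClasses E E) = Quot.mk _ (𝟙 E) := by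
    obtain ⟨s, hs⟩ := (hq E hE).2 (Quot.mk _ (𝟙 E))
    induction s using Quot.ind with | _ s
    exact ⟨s, hs⟩
  -- Injectivity of precomposition with `q` makes the one-sided homotopy inverse `s` two-sided.
  have hs' : (Quot.mk _ (s ≫ q) : HomotopyClasses B B) = Quot.mk _ (𝟙 B) := by
    apply (hq B hB).1
    have := HomotopyClasses.mk_postcomp q hs
    rw [Category.id_comp, Category.assoc] at this
    refine this.trans ?_
    exact congrArg (Quot.mk _) (Category.comp_id q).symm
  obtain ⟨t, ht, hst⟩ := exists_section_of_homotopy q _ (Quot.eqvGen_exact hs') s rfl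
  have ht' : (Quot.mk _ (q ≫ t) : HomotopyClasses E E) = Quot.mk _ (𝟙 E) :=
    (congrArg (HomotopyClasses.precomp q E) hst).symm.trans hs
  rintro _ _ _ ⟨n⟩
  -- The homotopy from `q ≫ t` to `𝟙 E` need not be fibrewise over `B`. So solvability of lifting
  -- problems is transported along it, for problems whose upper edge is deformed by `a`.
  let P (a : E ⟶ E) : Prop := ∀ (u : (∂Δ[n] : SSet.{w}) ⟶ E) (v : Δ[n] ⟶ B),
    (SSet.boundary n).ι ≫ v = u ≫ a ≫ q →
      ∃ l : Δ[n] ⟶ E, (SSet.boundary n).ι ≫ l = u ≫ a ∧ l ≫ q = v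
  have step (a b : E ⟶ E) (e e' : Fin 2) (H : E ⊗ Δ[1] ⟶ E)
      (ha : endpointInclusion E e ≫ H = a) (hb : endpointInclusion E e' ≫ H = b)
      (hP : P a) : P b := by
    intro u v huv
    -- Because `B` is Kan, the deformation of the boundary extends to a homotopy `V` of the lower
    -- edge ending at `v`. A solution at the end `e` then spreads over `V`, relative to the
    -- boundary.
    obtain ⟨V, -, hV₁, hV₂⟩ := exists_homotopy_lift (SSet.boundary n) (terminal.from B) e'
      (terminal.from _) (u ▷ _ ≫ H ≫ q) v (Subsingleton.elim _ _) (Subsingleton.elim _ _)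
      (by rw [huv, ← hb, endpointInclusion_whiskerRight_assoc, Category.assoc])
    obtain ⟨l, hl₁, hl₂⟩ := hP u (endpointInclusion _ e ≫ V) (by
      rw [← endpointInclusion_whiskerRight_assoc, hV₁, endpointInclusion_whiskerRight_assoc,
        ← ha, Category.assoc])
    obtain ⟨W, hW₁, hW₂, hW₃⟩ := exists_homotopy_lift (SSet.boundary n) q e V (u ▷ _ ≫ H) l
      (by rw [hV₁, Category.assoc]) hl₂.symm
      (by rw [hl₁, ← ha, endpointInclusion_whiskerRight_assoc])
    refine ⟨endpointInclusion _ e' ≫ W, ?_, ?_⟩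
    · rw [← endpointInclusion_whiskerRight_assoc, hW₂, endpointInclusion_whiskerRight_assoc, hb]
    · rw [Category.assoc, hW₁, hV₂]
  have hP : P (q ≫ t) ↔ P (𝟙 E) := by
    have := Quot.eqvGen_exact ht'
    generalize q ≫ t = a, 𝟙 E = b at this
    induction this with
    | rel a b h =>
      obtain ⟨H, h₀, h₁⟩ := (nonempty_homotopy_iff _ _).1 h
      exact ⟨step a b 0 1 H h₀ h₁, step b a 1 0 H h₁ h₀⟩
    | refl => rfl
    | symm _ _ _ ih => exact ih.symm
    | trans _ _ _ _ _ ih₁ ih₂ => exact ih₁.trans ih₂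
  -- For `q ≫ t` the map `v ≫ t` is a solution, `t` being a strict section.
  have hP' : P (𝟙 E) := hP.1 (fun u v huv ↦ ⟨v ≫ t, by
    rw [Category.assoc, ht, Category.comp_id] at huv
    rw [← Category.assoc, huv, Category.assoc], by rw [Category.assoc, ht, Category.comp_id]⟩)
  refine ⟨fun {u v} sq ↦ ?_⟩
  obtain ⟨l, hl₁, hl₂⟩ := hP' u v (by rw [Category.id_comp, sq.w])
  exact ⟨⟨⟨l, by rw [hl₁, Category.comp_id], hl₂⟩⟩⟩

end SSetHomotopy

/-! ### Unions of facets of the standard simplex -/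

section Facets

/-- The pushout square which glues the image of a monomorphism to a subcomplex. -/
lemma isPushout_preimage {D X : SSet.{w}} (δ : D ⟶ X) [Mono δ] (U V : X.Subcomplex)
    (h : U ⊔ SSet.Subcomplex.range δ = V) (hU : U ≤ V) (hδ : SSet.Subcomplex.range δ ≤ V) :
    IsPushout (U.preimage δ).ι (U.fromPreimage δ) (SSet.Subcomplex.lift δ hδ)
      (SSet.Subcomplex.homOfLE hU) := by
  let R := SSet.Subcomplex.range δ
  have sq : SSet.Subcomplex.BicartSq (U ⊓ R) R U V :=
    { sup_eq := by rw [← h, sup_comm]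
      inf_eq := inf_comm _ _ }
  let α : ((U.preimage δ : D.Subcomplex) : SSet.{w}) ⟶ ((U ⊓ R : X.Subcomplex) : SSet.{w}) :=
    SSet.Subcomplex.lift ((U.preimage δ).ι ≫ δ) (by
      rintro m _ ⟨⟨x, hx⟩, rfl⟩
      exact ⟨hx, ⟨x, rfl⟩⟩)
  have hδ' (m) : Function.Injective (δ.app m) := by
    rw [← mono_iff_injective]
    infer_instance
  have hα : IsIso α := by
    rw [NatTrans.isIso_iff_isIso_app]
    intro m
    rw [isIso_iff_bijective]
    constructor
    · intro x y hxy
      apply Subtype.ext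
      exact hδ' m (congrArg Subtype.val hxy)
    · rintro ⟨_, hx, ⟨y, rfl⟩⟩
      exact ⟨⟨y, hx⟩, rfl⟩
  refine sq.isPushout.of_iso (asIso α).symm (asIso (SSet.Subcomplex.toRange δ)).symm
    (Iso.refl _) (Iso.refl _) ?_ ?_ ?_ ?_
  · rw [← cancel_mono (asIso (SSet.Subcomplex.toRange δ)).hom, ← cancel_epi (asIso α).hom]
    simp
    rfl
  · rw [← cancel_epi (asIso α).hom]
    simp
    rfl
  · rw [← cancel_epi (asIso (SSet.Subcomplex.toRange δ)).hom]
    simp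
    rfl
  · rfl

/-- The union of the facets of `Δ[n]` opposite to the vertices in `S`. -/
def facets (n : ℕ) (S : Set (Fin (n + 1))) : (Δ[n] : SSet.{w}).Subcomplex where
  obj m := {σ | ∃ i ∈ S, i ∉ Set.range (SSet.stdSimplex.asOrderHom σ)}
  map f σ := by
    rintro ⟨i, hi, h⟩
    refine ⟨i, hi, fun ⟨j, hj⟩ ↦ h ⟨f.unop.toOrderHom j, hj⟩⟩

lemma facets_univ (n : ℕ) : facets.{w} n Set.univ = SSet.boundary n := by
  ext m σ
  change (∃ i ∈ _, _) ↔ ¬ Function.Surjective _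
  simp [Function.Surjective]

lemma facets_compl_singleton (n : ℕ) (k : Fin (n + 1)) :
    facets.{w} n {k}ᶜ = SSet.horn n k := by
  ext m σ
  change (∃ i ∈ _, _) ↔ _ ≠ _
  rw [Set.ne_univ_iff_exists_notMem]
  simp

lemma facets_empty (n : ℕ) : facets.{w} n ∅ = ⊥ := by
  rw [eq_bot_iff]
  rintro m σ ⟨i, hi, -⟩
  exact hi.elim

lemma facets_mono {n : ℕ} {S T : Set (Fin (n + 1))} (h : S ⊆ T) :
    facets.{w} n S ≤ facets n T := fun _ _ ⟨i, hi, hi'⟩ ↦ ⟨i, h hi, hi'⟩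

lemma preimage_facets {n : ℕ} (S : Set (Fin (n + 2))) (i : Fin (n + 2)) (hi : i ∉ S) :
    (facets.{w} (n + 1) S).preimage (SSet.stdSimplex.δ i) = facets n (i.succAbove ⁻¹' S) := by
  ext m σ
  constructor
  · rintro ⟨j, hj, h⟩
    obtain ⟨j, rfl⟩ := Fin.exists_succAbove_eq (x := j) (y := i) (by rintro rfl; exact hi hj)
    exact ⟨j, hj, fun ⟨k, hk⟩ ↦ h ⟨k, congrArg i.succAbove hk⟩⟩
  · rintro ⟨j, hj, h⟩
    exact ⟨_, hj, fun ⟨k, hk⟩ ↦ h ⟨k, Fin.succAbove_right_injective hk⟩⟩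

lemma range_δ_le_facets {n : ℕ} {S : Set (Fin (n + 2))} {i : Fin (n + 2)} (hi : i ∈ S) :
    SSet.Subcomplex.range (SSet.stdSimplex.δ i) ≤ facets.{w} (n + 1) S := by
  rintro m _ ⟨σ, rfl⟩
  exact ⟨i, hi, fun ⟨k, hk⟩ ↦ Fin.succAbove_ne _ _ hk⟩

lemma facets_sup_range_δ {n : ℕ} (S : Set (Fin (n + 2))) (i : Fin (n + 2)) :
    facets.{w} (n + 1) S ⊔ SSet.Subcomplex.range (SSet.stdSimplex.δ i) =
      facets (n + 1) (insert i S) := by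
  apply le_antisymm
  · exact sup_le (facets_mono (Set.subset_insert _ _)) (range_δ_le_facets (Set.mem_insert _ _))
  · rintro m σ ⟨j, hj | hj, h⟩
    · subst hj
      refine Or.inr ?_
      induction m using Opposite.rec with | _ m
      induction m using SimplexCategory.rec with | _ m
      have : ∀ k, ∃ l, j.succAbove l = σ k := fun k ↦
        Fin.exists_succAbove_eq (fun hk ↦ h ⟨k, hk⟩)
      choose f hf using this
      refine ⟨SSet.stdSimplex.objMk ⟨f, fun a b hab ↦ ?_⟩, ?_⟩
      · rw [← (Fin.strictMono_succAbove j).le_iff_le, hf, hf]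
        exact SSet.stdSimplex.monotone_apply σ hab
      · apply SSet.stdSimplex.ext
        exact hf
    · exact Or.inl ⟨j, hj, h⟩

/-- The facet `i` as a map to a union of facets which contains it. -/
def facetMap {n : ℕ} {S : Set (Fin (n + 2))} {i : Fin (n + 2)} (hi : i ∈ S) :
    (Δ[n] : SSet.{w}) ⟶ facets.{w} (n + 1) S :=
  SSet.Subcomplex.lift (SSet.stdSimplex.δ i) (range_δ_le_facets hi)

/-- The restriction of the facet `i` to a union of facets. -/
def facetRestriction {n : ℕ} (S : Set (Fin (n + 2))) (i : Fin (n + 2)) (hi : i ∉ S) :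
    (facets.{w} n (i.succAbove ⁻¹' S) : SSet.{w}) ⟶ facets.{w} (n + 1) S :=
  SSet.Subcomplex.lift ((facets n _).ι ≫ SSet.stdSimplex.δ i) (by
    rintro m _ ⟨⟨σ, hσ⟩, rfl⟩
    rwa [← preimage_facets S i hi] at hσ)

/-- The facet `i` meets the union of the facets in `S` in a union of facets of `Δ[n]`. This square,
which adds one facet at the cost of one dimension less, drives all the inductions on `n` and `S`
below. -/
lemma isPushout_facets {n : ℕ} (S : Set (Fin (n + 2))) (i : Fin (n + 2)) (hi : i ∉ S) :
    IsPushout (facets.{w} n (i.succAbove ⁻¹' S)).ι (facetRestriction S i hi)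
      (facetMap (Set.mem_insert i S))
      (SSet.Subcomplex.homOfLE (facets_mono (Set.subset_insert i S))) := by
  have : Mono (SSet.stdSimplex.{w}.δ i) := inferInstance
  refine (isPushout_preimage (SSet.stdSimplex.δ i) (facets.{w} (n + 1) S) _
    (facets_sup_range_δ S i) (facets_mono (Set.subset_insert i S))
    (range_δ_le_facets (Set.mem_insert i S))).of_iso
    (SSet.Subcomplex.eqToIso (preimage_facets S i hi)) (Iso.refl _) (Iso.refl _) (Iso.refl _)
    rfl rfl rfl rfl

end Facets

/-! ### The adjunction between tensors and singular complexes -/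

section Tensor

variable {D : Type u} [Category.{w} D]

lemma yonedaEquiv_map_comp {L : SSet.{w}} {m m' : SimplexCategory} (f : m' ⟶ m)
    (x : SSet.stdSimplex.obj m ⟶ L) :
    SSet.yonedaEquiv (SSet.stdSimplex.map f ≫ x) = L.map f.op (SSet.yonedaEquiv x) := by
  refine Eq.trans ?_ (ConcreteCategory.congr_hom (x.naturality f.op)
    (SSet.stdSimplex.objEquiv.symm (𝟙 m)))
  refine congrArg (x.app (op m')) (SSet.stdSimplex.objEquiv.injective ?_)
  exact (Category.id_comp f).trans (Category.comp_id f).symm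

lemma map_comp_yonedaEquiv_symm {L : SSet.{w}} {m m' : SimplexCategory} (f : m' ⟶ m)
    (x : L.obj (op m)) :
    SSet.stdSimplex.map f ≫ SSet.yonedaEquiv.symm x = SSet.yonedaEquiv.symm (L.map f.op x) := by
  apply SSet.yonedaEquiv.injective
  rw [yonedaEquiv_map_comp, Equiv.apply_symm_apply, Equiv.apply_symm_apply]

/-- The simplicial set `D(A^•, X)`. -/
def singular (A : SimplexCategory ⥤ D) : D ⥤ SSet.{w} where
  obj X := A.op ⋙ yoneda.obj X
  map f := Functor.whiskerLeft A.op (yoneda.map f)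

/-- The map `D(A'^•, X) ⟶ D(A^•, X)` induced by `τ : A ⟶ A'`. -/
def singularTrans {A A' : SimplexCategory ⥤ D} (τ : A ⟶ A') :
    singular A' ⟶ singular A where
  app X := Functor.whiskerRight (NatTrans.op τ) (yoneda.obj X)
  naturality X Y f := by
    ext m x
    exact (Category.assoc (τ.app m.unop) x f).symm

variable [HasColimits D] (A : SimplexCategory ⥤ D)

/-- The map `A⁽ᵐ⁾ ⟶ A ⊗ L` which corresponds to a simplex `Δ[m] ⟶ L`. -/
def tensorι {L : SSet.{w}} {m : SimplexCategory} (x : SSet.stdSimplex.obj m ⟶ L) :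
    A.obj m ⟶ tensorObj A L :=
  colimit.ι (CostructuredArrow.proj simplexFunctor.{w} L ⋙ A)
    (CostructuredArrow.mk (S := simplexFunctor.{w}) x)

lemma map_tensorι {L : SSet.{w}} {m m' : SimplexCategory} (f : m' ⟶ m)
    (x : SSet.stdSimplex.obj m ⟶ L) :
    A.map f ≫ tensorι A x = tensorι A (SSet.stdSimplex.map f ≫ x) :=
  colimit.w (CostructuredArrow.proj simplexFunctor.{w} L ⋙ A)
    (CostructuredArrow.homMk (S := simplexFunctor.{w}) f rfl :
      CostructuredArrow.mk (S := simplexFunctor.{w}) (SSet.stdSimplex.map f ≫ x) ⟶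
        CostructuredArrow.mk (S := simplexFunctor.{w}) x)

variable {A} in
lemma tensorObj_hom_ext {L : SSet.{w}} {X : D} {f g : tensorObj A L ⟶ X}
    (h : ∀ (m : SimplexCategory) (x : SSet.stdSimplex.obj m ⟶ L),
      tensorι A x ≫ f = tensorι A x ≫ g) : f = g :=
  colimit.hom_ext (fun σ ↦ h σ.left σ.hom)

lemma tensorι_tensorMap {L L' : SSet.{w}} {m : SimplexCategory} (x : SSet.stdSimplex.obj m ⟶ L)
    (f : L ⟶ L') : tensorι A x ≫ tensorMap A f = tensorι A (x ≫ f) :=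
  colimit.ι_pre (CostructuredArrow.proj simplexFunctor.{w} L' ⋙ A) (CostructuredArrow.map f)
    (CostructuredArrow.mk (S := simplexFunctor.{w}) x)

lemma tensorι_tensorMap_assoc {L L' : SSet.{w}} {m : SimplexCategory}
    (x : SSet.stdSimplex.obj m ⟶ L) (f : L ⟶ L') {Z : D} (g : tensorObj A L' ⟶ Z) :
    tensorι A x ≫ tensorMap A f ≫ g = tensorι A (x ≫ f) ≫ g := by
  rw [← Category.assoc, tensorι_tensorMap]

/-- Constructor for morphisms from `A ⊗ L`. -/
def tensorDesc {L : SSet.{w}} {X : D} (φ : L ⟶ (singular A).obj X) : tensorObj A L ⟶ X :=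
  colimit.desc (CostructuredArrow.proj simplexFunctor.{w} L ⋙ A)
    { pt := X
      ι :=
        { app σ := φ.app (op σ.left) (SSet.yonedaEquiv σ.hom)
          naturality σ τ f := by
            have h : SSet.yonedaEquiv σ.hom = L.map f.left.op (SSet.yonedaEquiv τ.hom) := by
              rw [← CostructuredArrow.w f]
              exact yonedaEquiv_map_comp f.left τ.hom
            refine Eq.trans ?_ (Category.comp_id _).symm
            rw [h]
            exact (ConcreteCategory.congr_hom (φ.naturality f.left.op)
              (SSet.yonedaEquiv τ.hom)).symm } }

lemma tensorι_tensorDesc {L : SSet.{w}} {X : D} (φ : L ⟶ (singular A).obj X)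
    {m : SimplexCategory} (x : SSet.stdSimplex.obj m ⟶ L) :
    tensorι A x ≫ tensorDesc A φ = φ.app (op m) (SSet.yonedaEquiv x) :=
  colimit.ι_desc _ _

/-- Morphisms `A ⊗ L ⟶ X` correspond to morphisms `L ⟶ D(A^•, X)`. -/
def tensorHomEquiv (L : SSet.{w}) (X : D) :
    (tensorObj A L ⟶ X) ≃ (L ⟶ (singular A).obj X) where
  toFun f :=
    { app m := ↾fun x ↦ tensorι A (SSet.yonedaEquiv.symm x) ≫ f
      naturality m m' g := by
        ext x
        change _ = A.map g.unop ≫ tensorι A (SSet.yonedaEquiv.symm x) ≫ f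
        rw [← Category.assoc, map_tensorι, map_comp_yonedaEquiv_symm]
        rfl }
  invFun φ := tensorDesc A φ
  left_inv f := by
    apply tensorObj_hom_ext
    intro m x
    rw [tensorι_tensorDesc]
    change tensorι A (SSet.yonedaEquiv.symm (SSet.yonedaEquiv x)) ≫ f = _
    rw [Equiv.symm_apply_apply]
  right_inv φ := by
    ext m x
    change tensorι A (SSet.yonedaEquiv.symm x) ≫ tensorDesc A φ = _
    rw [tensorι_tensorDesc, Equiv.apply_symm_apply]
    rfl

/-- The functor `L ↦ A ⊗ L`. -/
def tensorFunctor : SSet.{w} ⥤ D where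
  obj := tensorObj A
  map f := tensorMap A f
  map_id L := by
    apply tensorObj_hom_ext
    intro m x
    rw [tensorι_tensorMap, Category.comp_id, Category.comp_id]
  map_comp f g := by
    apply tensorObj_hom_ext
    intro m x
    rw [tensorι_tensorMap, tensorι_tensorMap_assoc, tensorι_tensorMap, Category.assoc]

/-- The functor `A ⊗ -` is left adjoint to the functor `D(A^•, -)`. -/
def tensorAdj : tensorFunctor A ⊣ singular A :=
  Adjunction.mkOfHomEquiv
    { homEquiv := tensorHomEquiv A
      homEquiv_naturality_left_symm f g := by
        apply tensorObj_hom_ext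
        intro m x
        change tensorι A x ≫ tensorDesc A _ = tensorι A x ≫ tensorMap A f ≫ tensorDesc A g
        rw [tensorι_tensorMap_assoc, tensorι_tensorDesc, tensorι_tensorDesc]
        rfl
      homEquiv_naturality_right f g := by
        ext m x
        exact (Category.assoc _ _ _).symm }

instance : (tensorFunctor A).IsLeftAdjoint := ⟨_, ⟨tensorAdj A⟩⟩

section

variable {A} {B : SimplexCategory ⥤ D} (τ : A ⟶ B)

/-- The map `A ⊗ L ⟶ B ⊗ L` induced by `A ⟶ B`. -/
def tensorTransApp (L : SSet.{w}) : tensorObj A L ⟶ tensorObj B L :=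
  tensorDesc A (tensorHomEquiv B L _ (𝟙 _) ≫ (singularTrans τ).app _)

lemma tensorι_tensorTransApp {L : SSet.{w}} {m : SimplexCategory}
    (x : SSet.stdSimplex.obj m ⟶ L) :
    tensorι A x ≫ tensorTransApp τ L = τ.app m ≫ tensorι B x := by
  refine (tensorι_tensorDesc _ _ _).trans ?_
  change τ.app m ≫ tensorι B (SSet.yonedaEquiv.symm (SSet.yonedaEquiv x)) ≫ 𝟙 _ = _
  rw [Equiv.symm_apply_apply, Category.comp_id]

lemma tensorι_tensorTransApp_assoc {L : SSet.{w}} {m : SimplexCategory}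
    (x : SSet.stdSimplex.obj m ⟶ L) {Z : D} (f : tensorObj B L ⟶ Z) :
    tensorι A x ≫ tensorTransApp τ L ≫ f = τ.app m ≫ tensorι B x ≫ f := by
  rw [← Category.assoc, tensorι_tensorTransApp, Category.assoc]

lemma tensorMap_tensorTransApp {L L' : SSet.{w}} (f : L ⟶ L') :
    tensorMap A f ≫ tensorTransApp τ L' = tensorTransApp τ L ≫ tensorMap B f := by
  apply tensorObj_hom_ext
  intro m x
  rw [tensorι_tensorMap_assoc, tensorι_tensorTransApp, tensorι_tensorTransApp_assoc,
    tensorι_tensorMap]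

/-- The natural transformation `A ⊗ - ⟶ B ⊗ -` induced by `A ⟶ B`. -/
def tensorTrans : tensorFunctor A ⟶ tensorFunctor B where
  app L := tensorTransApp τ L
  naturality _ _ f := tensorMap_tensorTransApp τ f

end

/-- The isomorphism `A ⊗ Δ[m] ≅ A⁽ᵐ⁾`. -/
def tensorStdSimplexIso (m : SimplexCategory) :
    tensorObj A (SSet.stdSimplex.{w}.obj m) ≅ A.obj m where
  hom := colimit.desc (CostructuredArrow.proj simplexFunctor.{w} (SSet.stdSimplex.{w}.obj m) ⋙ A)
    { pt := A.obj m
      ι :=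
        { app σ := A.map (SSet.stdSimplex.fullyFaithful.preimage σ.hom)
          naturality σ τ f := by
            refine Eq.trans ?_ (Category.comp_id _).symm
            refine (A.map_comp _ _).symm.trans (congrArg A.map ?_)
            apply SSet.stdSimplex.{w}.map_injective
            refine (Functor.map_comp _ _ _).trans ?_
            refine (congrArg (SSet.stdSimplex.{w}.map f.left ≫ ·)
              (SSet.stdSimplex.fullyFaithful.map_preimage τ.hom)).trans ?_
            exact (CostructuredArrow.w f).trans
              (SSet.stdSimplex.fullyFaithful.map_preimage σ.hom).symm } }
  inv := tensorι A (𝟙 _)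
  hom_inv_id := by
    apply tensorObj_hom_ext
    intro k x
    refine ((Category.assoc _ _ _).symm.trans (congrArg (· ≫ tensorι A (𝟙 _))
      (colimit.ι_desc _ _))).trans ?_
    refine (map_tensorι A _ _).trans ?_
    rw [Category.comp_id, Category.comp_id]
    exact congrArg (tensorι A) (SSet.stdSimplex.fullyFaithful.map_preimage x)
  inv_hom_id := by
    refine (colimit.ι_desc _ _).trans ?_
    refine (congrArg A.map ?_).trans (A.map_id m)
    apply SSet.stdSimplex.{w}.map_injective
    exact (SSet.stdSimplex.fullyFaithful.map_preimage _).trans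
      (CategoryTheory.Functor.map_id _ _).symm

lemma tensorι_tensorStdSimplexIso_hom {m k : SimplexCategory} (f : k ⟶ m) :
    tensorι A (SSet.stdSimplex.{w}.map f) ≫ (tensorStdSimplexIso A m).hom = A.map f := by
  have h := map_tensorι A f (𝟙 (SSet.stdSimplex.{w}.obj m))
  rw [Category.comp_id] at h
  rw [← h, Category.assoc]
  exact (congrArg (A.map f ≫ ·) (tensorStdSimplexIso A m).inv_hom_id).trans (Category.comp_id _)

lemma tensorStdSimplexIso_inv_tensorMap {m k : SimplexCategory} (f : k ⟶ m) :
    (tensorStdSimplexIso A k).inv ≫ tensorMap A (SSet.stdSimplex.{w}.map f) =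
      A.map f ≫ (tensorStdSimplexIso A m).inv := by
  refine (tensorι_tensorMap A _ _).trans (Eq.trans ?_ (map_tensorι A _ _).symm)
  rw [Category.comp_id, Category.id_comp]

/-- Allows the Reedy conditions to be read off from the values of the left adjoint `tensorFunctor A`
on boundary inclusions. -/
lemma latchingMap_eq (n : ℕ) :
    latchingMap A n =
      tensorMap A (SSet.boundary.{w} n).ι ≫ (tensorStdSimplexIso A ⦋n⦌).hom := by
  apply tensorObj_hom_ext
  intro m x
  refine (colimit.ι_desc _ _).trans ?_
  rw [← Category.assoc, tensorι_tensorMap]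
  refine Eq.trans ?_ (congrArg (· ≫ (tensorStdSimplexIso A ⦋n⦌).hom) (congrArg (tensorι A)
    (SSet.stdSimplex.fullyFaithful.map_preimage (x ≫ (SSet.boundary.{w} n).ι))))
  exact (tensorι_tensorStdSimplexIso_hom A _).symm

end Tensor

/-! ### Reedy cofibrant functors on simplicial sets -/

section Reedy

lemma weakEquivalence_of_isPushout {D : Type u} [Category.{w} D] [ModelCategory D]
    {X₁ X₂ X₃ X₄ : D} {f : X₁ ⟶ X₂} {g : X₁ ⟶ X₃} {h : X₂ ⟶ X₄} {k : X₃ ⟶ X₄}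
    (sq : IsPushout f g h k) [Cofibration f] [WeakEquivalence f] : WeakEquivalence k := by
  rw [weakEquivalence_iff]
  exact ((trivialCofibrations D).of_isPushout sq.flip (mem_trivialCofibrations f)).2

lemma cofibration_of_isPushout {D : Type u} [Category.{w} D] [ModelCategory D]
    {X₁ X₂ X₃ X₄ : D} {f : X₁ ⟶ X₂} {g : X₁ ⟶ X₃} {h : X₂ ⟶ X₄} {k : X₃ ⟶ X₄}
    (sq : IsPushout f g h k) [hf : Cofibration f] : Cofibration k := by
  rw [cofibration_iff] at hf ⊢
  exact (cofibrations D).of_isPushout sq.flip hf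

variable {D : Type u} [Category.{w} D]

section

variable [ModelCategory D] (F : SSet.{w} ⥤ D)

/-- A left adjoint functor on simplicial sets which corresponds to a Reedy cofibrant
homotopically constant cosimplicial object. -/
structure IsReedyCofibrantConstant : Prop where
  isLeftAdjoint : F.IsLeftAdjoint
  cofibration (n : ℕ) : Cofibration (F.map (SSet.boundary.{w} n).ι)
  weakEquivalence {m n : SimplexCategory} (f : m ⟶ n) :
    WeakEquivalence (F.map (SSet.stdSimplex.map f))

/-- Descending induction on `S` from the full boundary: when a facet is removed, the new inclusion
is a pushout of a lower-dimensional one followed by the old inclusion. -/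
lemma cofibration_map_facets [F.IsLeftAdjoint]
    (hF : ∀ n : ℕ, Cofibration (F.map (SSet.boundary.{w} n).ι)) (n : ℕ) (S : Set (Fin (n + 1))) :
    Cofibration (F.map (facets.{w} n S).ι) := by
  induction n with
  | zero =>
    -- As `∂Δ[0]` is empty, both subsets of `Fin 1` give the empty subcomplex.
    obtain h | h := Set.eq_empty_or_nonempty S
    · have : facets.{w} 0 S = SSet.boundary 0 := by
        rw [h, facets_empty, SSet.boundary_zero]
      rw [this]
      exact hF 0
    · have : S = Set.univ := by
        rw [Set.eq_univ_iff_forall]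
        obtain ⟨x, hx⟩ := h
        intro y
        rwa [Fin.fin_one_eq_zero y, ← Fin.fin_one_eq_zero x]
      rw [this, facets_univ]
      exact hF 0
  | succ n hn =>
    suffices ∀ T : Set (Fin (n + 2)), Cofibration (F.map (facets.{w} (n + 1) Tᶜ).ι) by
      rw [← compl_compl S]
      exact this _
    intro T
    refine Set.Finite.induction_on T T.toFinite ?_ ?_
    · rw [Set.compl_empty, facets_univ]
      exact hF _
    · intro i T hi _ hT
      have h₁ : i ∉ (insert i T)ᶜ := by simp
      have h₂ : insert i (insert i T)ᶜ = Tᶜ := by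
        ext j
        by_cases hj : j = i
        · subst hj; simpa using hi
        · simp [hj]
      have sq := (isPushout_facets _ i h₁).map F
      have := hn (i.succAbove ⁻¹' (insert i T)ᶜ)
      have := cofibration_of_isPushout sq
      rw [← h₂] at hT
      have e : F.map (facets.{w} (n + 1) (insert i T)ᶜ).ι =
          F.map (SSet.Subcomplex.homOfLE (facets_mono (Set.subset_insert i _))) ≫
            F.map (facets.{w} (n + 1) (insert i (insert i T)ᶜ)).ι := by
        rw [← F.map_comp]
        rfl
      rw [e]
      infer_instance

/-- The inclusion of one facet is an isomorphism onto the corresponding subcomplex. -/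
lemma isIso_facetMap_singleton {n : ℕ} (i : Fin (n + 2)) :
    IsIso (facetMap.{w} (Set.mem_insert i ∅)) := by
  have h₁ : IsInitial (facets.{w} n (i.succAbove ⁻¹' ∅) : SSet.{w}) := by
    rw [Set.preimage_empty, facets_empty]
    exact SSet.Subcomplex.isInitialBot
  have h₂ : IsInitial (facets.{w} (n + 1) ∅ : SSet.{w}) := by
    rw [facets_empty]
    exact SSet.Subcomplex.isInitialBot
  have : IsIso (facetRestriction.{w} ∅ i (Set.notMem_empty i)) :=
    isIso_of_isInitial h₁ h₂ _
  exact (isPushout_facets.{w} ∅ i (Set.notMem_empty i)).isIso_inl_of_isIso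

-- Ascending induction on `S`. A single facet is a coface map, hence a weak equivalence by
-- constancy; each further facet is glued along a trivial cofibration of lower dimension, and two
-- out of three applies. Horns are the case where one facet is missing.
variable {F} in
lemma IsReedyCofibrantConstant.weakEquivalence_facets (hF : IsReedyCofibrantConstant F) (n : ℕ)
    (S : Set (Fin (n + 1))) (hS : S.Nonempty) (hS' : S ≠ Set.univ) :
    WeakEquivalence (F.map (facets.{w} n S).ι) := by
  have := hF.isLeftAdjoint
  induction n with
  | zero =>
    exfalso
    apply hS'
    rw [Set.eq_univ_iff_forall]
    obtain ⟨x, hx⟩ := hS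
    intro y
    rwa [Fin.fin_one_eq_zero y, ← Fin.fin_one_eq_zero x]
  | succ n hn =>
    refine Set.Finite.induction_on (motive := fun S _ ↦ S.Nonempty → S ≠ Set.univ →
      WeakEquivalence (F.map (facets.{w} (n + 1) S).ι)) S S.toFinite ?_ ?_ hS hS'
    · intro h
      simp at h
    · intro i T hi _ hT _ hT'
      obtain rfl | hT₀ := Set.eq_empty_or_nonempty T
      · have := isIso_facetMap_singleton.{w} i
        have e : F.map (facetMap.{w} (Set.mem_insert i ∅)) ≫
            F.map (facets.{w} (n + 1) (insert i ∅)).ι =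
              F.map (SSet.stdSimplex.map (SimplexCategory.δ i)) := by
          rw [← F.map_comp]
          rfl
        have := hF.weakEquivalence (SimplexCategory.δ i)
        exact weakEquivalence_of_precomp_of_fac e
      · have hT₁ : T ≠ Set.univ := by
          rintro rfl
          simp at hi
        have := hT hT₀ hT₁
        have := cofibration_map_facets F hF.cofibration n (i.succAbove ⁻¹' T)
        have := hn (i.succAbove ⁻¹' T) (by
          obtain ⟨j, hj⟩ := hT₀
          obtain ⟨j, rfl⟩ := Fin.exists_succAbove_eq (x := j) (y := i)
            (by rintro rfl; exact hi hj)
          exact ⟨j, hj⟩) (by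
          intro h
          apply hT'
          rw [Set.eq_univ_iff_forall] at h ⊢
          intro j
          by_cases hj : j = i
          · exact Or.inl hj
          · obtain ⟨j, rfl⟩ := Fin.exists_succAbove_eq hj
            exact Or.inr (h j))
        have := weakEquivalence_of_isPushout ((isPushout_facets T i hi).map F)
        have e : F.map (SSet.Subcomplex.homOfLE (facets_mono (Set.subset_insert i T))) ≫
            F.map (facets.{w} (n + 1) (insert i T)).ι = F.map (facets.{w} (n + 1) T).ι := by
          rw [← F.map_comp]
          rfl
        exact weakEquivalence_of_precomp_of_fac e

end

/-! ### Relative latching maps of a natural transformation. -/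

section

variable [HasPushouts D] {F G : SSet.{w} ⥤ D} (τ : F ⟶ G)

/-- The relative latching map `F(L) ∪_{F(K)} G(K) ⟶ G(L)` of a natural transformation `F ⟶ G`
at a morphism `K ⟶ L`. -/
def relativeLatchingMap {K L : SSet.{w}} (i : K ⟶ L) :
    pushout (F.map i) (τ.app K) ⟶ G.obj L :=
  pushout.desc (τ.app L) (G.map i) (τ.naturality i)

/-- The map between the sources of the relative latching maps of `f` and of `l`
for a commutative square from `f` to `l`. -/
def relativeLatchingSourceMap {K L K' L' : SSet.{w}} {i : K ⟶ L} {i' : K' ⟶ L'} (a : K ⟶ K')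
    (b : L ⟶ L') (w : i ≫ b = a ≫ i') :
    pushout (F.map i) (τ.app K) ⟶ pushout (F.map i') (τ.app K') :=
  pushout.map _ _ _ _ (F.map b) (G.map a) (F.map a)
    (by rw [← F.map_comp, ← F.map_comp, w]) (by simp)

lemma inl_relativeLatchingMap {K L : SSet.{w}} (i : K ⟶ L) :
    pushout.inl (F.map i) (τ.app K) ≫ relativeLatchingMap τ i = τ.app L :=
  pushout.inl_desc _ _ _

lemma inl_relativeLatchingMap_assoc {K L : SSet.{w}} (i : K ⟶ L) {Z : D} (g : G.obj L ⟶ Z) :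
    pushout.inl (F.map i) (τ.app K) ≫ relativeLatchingMap τ i ≫ g = τ.app L ≫ g := by
  rw [← Category.assoc, inl_relativeLatchingMap]

lemma inr_relativeLatchingMap {K L : SSet.{w}} (i : K ⟶ L) :
    pushout.inr (F.map i) (τ.app K) ≫ relativeLatchingMap τ i = G.map i :=
  pushout.inr_desc _ _ _

lemma inr_relativeLatchingMap_assoc {K L : SSet.{w}} (i : K ⟶ L) {Z : D} (g : G.obj L ⟶ Z) :
    pushout.inr (F.map i) (τ.app K) ≫ relativeLatchingMap τ i ≫ g = G.map i ≫ g := by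
  rw [← Category.assoc, inr_relativeLatchingMap]

section

variable {K L K' L' : SSet.{w}} {i : K ⟶ L} {i' : K' ⟶ L'} (a : K ⟶ K') (b : L ⟶ L')
  (w : i ≫ b = a ≫ i')

lemma inl_relativeLatchingSourceMap :
    pushout.inl (F.map i) (τ.app K) ≫ relativeLatchingSourceMap τ a b w =
      F.map b ≫ pushout.inl (F.map i') (τ.app K') :=
  pushout.inl_desc _ _ _

lemma inl_relativeLatchingSourceMap_assoc {Z : D} (g : pushout (F.map i') (τ.app K') ⟶ Z) :
    pushout.inl (F.map i) (τ.app K) ≫ relativeLatchingSourceMap τ a b w ≫ g =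
      F.map b ≫ pushout.inl (F.map i') (τ.app K') ≫ g := by
  rw [← Category.assoc, inl_relativeLatchingSourceMap, Category.assoc]

lemma inr_relativeLatchingSourceMap :
    pushout.inr (F.map i) (τ.app K) ≫ relativeLatchingSourceMap τ a b w =
      G.map a ≫ pushout.inr (F.map i') (τ.app K') :=
  pushout.inr_desc _ _ _

lemma inr_relativeLatchingSourceMap_assoc {Z : D} (g : pushout (F.map i') (τ.app K') ⟶ Z) :
    pushout.inr (F.map i) (τ.app K) ≫ relativeLatchingSourceMap τ a b w ≫ g =
      G.map a ≫ pushout.inr (F.map i') (τ.app K') ≫ g := by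
  rw [← Category.assoc, inr_relativeLatchingSourceMap, Category.assoc]

lemma relativeLatchingSourceMap_comp :
    relativeLatchingSourceMap τ a b w ≫ relativeLatchingMap τ i' =
      relativeLatchingMap τ i ≫ G.map b := by
  apply pushout.hom_ext
  · rw [inl_relativeLatchingSourceMap_assoc, inl_relativeLatchingMap,
      inl_relativeLatchingMap_assoc, τ.naturality]
  · rw [inr_relativeLatchingSourceMap_assoc, inr_relativeLatchingMap,
      inr_relativeLatchingMap_assoc, ← G.map_comp, ← G.map_comp, w]

end

variable [F.IsLeftAdjoint] [G.IsLeftAdjoint]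

/-- Both functors preserve the given pushout. Passing from `K₃` to `K₄` over `L` thus attaches
`G(K₂)` to `F(L) ∪ G(K₃)` along `F(K₂) ∪ G(K₁)`. -/
lemma isPushout_relativeLatchingMap {K₁ K₂ K₃ K₄ L : SSet.{w}} {f : K₁ ⟶ K₂} {g : K₁ ⟶ K₃}
    {h : K₂ ⟶ K₄} {k : K₃ ⟶ K₄} (sq : IsPushout f g h k) (l : K₄ ⟶ L) :
    IsPushout (relativeLatchingMap τ f)
      (relativeLatchingSourceMap τ (i' := k ≫ l) g (h ≫ l) (by rw [sq.w_assoc]))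
      (G.map h ≫ pushout.inr (F.map l) (τ.app K₄))
      (relativeLatchingSourceMap τ k (𝟙 L) (Category.comp_id _)) := by
  have sqF := sq.map F
  have sqG := sq.map G
  refine ⟨⟨?_⟩, ⟨PushoutCocone.IsColimit.mk _ (fun s ↦ ?_) ?_ ?_ ?_⟩⟩
  · apply pushout.hom_ext
    · rw [inl_relativeLatchingMap_assoc, inl_relativeLatchingSourceMap_assoc,
        inl_relativeLatchingSourceMap, F.map_id, Category.id_comp, F.map_comp, Category.assoc,
        pushout.condition, τ.naturality_assoc]
    · rw [inr_relativeLatchingMap_assoc, inr_relativeLatchingSourceMap_assoc,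
        inr_relativeLatchingSourceMap, ← G.map_comp_assoc, ← G.map_comp_assoc, sq.w]
  · have w₁ : G.map f ≫ s.inl = G.map g ≫ pushout.inr (F.map (k ≫ l)) (τ.app K₃) ≫ s.inr := by
      have := pushout.inr (F.map f) (τ.app K₁) ≫= s.condition
      rwa [inr_relativeLatchingMap_assoc, inr_relativeLatchingSourceMap_assoc] at this
    refine pushout.desc (pushout.inl (F.map (k ≫ l)) (τ.app K₃) ≫ s.inr)
      (sqG.desc s.inl (pushout.inr (F.map (k ≫ l)) (τ.app K₃) ≫ s.inr) w₁) ?_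
    apply sqF.hom_ext
    · have := pushout.inl (F.map f) (τ.app K₁) ≫= s.condition
      rw [inl_relativeLatchingMap_assoc, inl_relativeLatchingSourceMap_assoc] at this
      rw [τ.naturality_assoc, sqG.inl_desc, this, ← F.map_comp_assoc]
    · rw [τ.naturality_assoc, sqG.inr_desc, ← F.map_comp_assoc, pushout.condition_assoc]
  · intro s
    rw [Category.assoc, pushout.inr_desc, sqG.inl_desc]
  · intro s
    apply pushout.hom_ext
    · rw [inl_relativeLatchingSourceMap_assoc, F.map_id, Category.id_comp, pushout.inl_desc]
    · rw [inr_relativeLatchingSourceMap_assoc, pushout.inr_desc, sqG.inr_desc]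
  · intro s m h₁ h₂
    apply pushout.hom_ext
    · rw [pushout.inl_desc, ← h₂, inl_relativeLatchingSourceMap_assoc, F.map_id,
        Category.id_comp]
    · rw [pushout.inr_desc]
      apply sqG.hom_ext
      · rw [sqG.inl_desc, ← h₁, Category.assoc]
      · rw [sqG.inr_desc, ← h₂, inr_relativeLatchingSourceMap_assoc]

end

section

variable [ModelCategory D] {F G : SSet.{w} ⥤ D} (τ : F ⟶ G)

/-- The descending induction of `cofibration_map_facets`, with the gluing square of
`isPushout_relativeLatchingMap`. -/
lemma cofibration_relativeLatchingMap_facets [F.IsLeftAdjoint] [G.IsLeftAdjoint]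
    (hτ : ∀ n : ℕ, Cofibration (relativeLatchingMap τ (SSet.boundary.{w} n).ι)) (n : ℕ)
    (S : Set (Fin (n + 1))) :
    Cofibration (relativeLatchingMap τ (facets.{w} n S).ι) := by
  induction n with
  | zero =>
    obtain h | h := Set.eq_empty_or_nonempty S
    · have : facets.{w} 0 S = SSet.boundary 0 := by
        rw [h, facets_empty, SSet.boundary_zero]
      rw [this]
      exact hτ 0
    · have : S = Set.univ := by
        rw [Set.eq_univ_iff_forall]
        obtain ⟨x, hx⟩ := h
        intro y
        rwa [Fin.fin_one_eq_zero y, ← Fin.fin_one_eq_zero x]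
      rw [this, facets_univ]
      exact hτ 0
  | succ n hn =>
    suffices ∀ T : Set (Fin (n + 2)),
        Cofibration (relativeLatchingMap τ (facets.{w} (n + 1) Tᶜ).ι) by
      rw [← compl_compl S]
      exact this _
    intro T
    refine Set.Finite.induction_on T T.toFinite ?_ ?_
    · rw [Set.compl_empty, facets_univ]
      exact hτ _
    · intro i T hi _ hT
      have h₁ : i ∉ (insert i T)ᶜ := by simp
      have h₂ : insert i (insert i T)ᶜ = Tᶜ := by
        ext j
        by_cases hj : j = i
        · subst hj; simpa using hi
        · simp [hj]
      rw [← h₂] at hT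
      have sq := isPushout_relativeLatchingMap τ (isPushout_facets _ i h₁)
        (facets.{w} (n + 1) (insert i (insert i T)ᶜ)).ι
      have := hn (i.succAbove ⁻¹' (insert i T)ᶜ)
      have := cofibration_of_isPushout sq
      have e := relativeLatchingSourceMap_comp τ
        (SSet.Subcomplex.homOfLE (facets_mono (Set.subset_insert i (insert i T)ᶜ))) (𝟙 _)
        (Category.comp_id
          (SSet.Subcomplex.homOfLE (facets_mono.{w} (Set.subset_insert i (insert i T)ᶜ)) ≫
            (facets.{w} (n + 1) (insert i (insert i T)ᶜ)).ι))
      rw [G.map_id, Category.comp_id] at e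
      change Cofibration (relativeLatchingMap τ
        (SSet.Subcomplex.homOfLE (facets_mono.{w} (Set.subset_insert i (insert i T)ᶜ)) ≫
            (facets.{w} (n + 1) (insert i (insert i T)ᶜ)).ι))
      rw [← e]
      infer_instance

lemma weakEquivalence_relativeLatchingMap {K L : SSet.{w}} (i : K ⟶ L)
    [Cofibration (F.map i)] [WeakEquivalence (F.map i)] [WeakEquivalence (G.map i)] :
    WeakEquivalence (relativeLatchingMap τ i) := by
  have := weakEquivalence_of_isPushout (IsPushout.of_hasPushout (F.map i) (τ.app K))
  have e : pushout.inr (F.map i) (τ.app K) ≫ relativeLatchingMap τ i = G.map i :=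
    pushout.inr_desc _ _ _
  exact weakEquivalence_of_precomp_of_fac e

/-- The relative latching map at a horn is a weak equivalence because `F` and `G` invert horn
inclusions up to homotopy. It differs from the one at the boundary by a pushout of the relative
latching map one degree lower, a trivial cofibration by induction. -/
lemma weakEquivalence_relativeLatchingMap_boundary (hF : IsReedyCofibrantConstant F)
    (hG : IsReedyCofibrantConstant G)
    (hτ : ∀ n : ℕ, Cofibration (relativeLatchingMap τ (SSet.boundary.{w} n).ι))
    (hτ' : ∀ n : ℕ, WeakEquivalence (τ.app Δ[n])) (n : ℕ) :
    WeakEquivalence (relativeLatchingMap τ (SSet.boundary.{w} n).ι) := by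
  have := hF.isLeftAdjoint
  have := hG.isLeftAdjoint
  induction n with
  | zero =>
    have h : IsInitial (∂Δ[0] : SSet.{w}) := by
      rw [SSet.boundary_zero]
      exact SSet.Subcomplex.isInitialBot
    have : IsIso (τ.app (∂Δ[0] : SSet.{w})) :=
      isIso_of_isInitial (h.isInitialObj F) (h.isInitialObj G) _
    have e : pushout.inl (F.map (SSet.boundary.{w} 0).ι) (τ.app _) ≫
        relativeLatchingMap τ (SSet.boundary.{w} 0).ι = τ.app Δ[0] :=
      pushout.inl_desc _ _ _
    have := hτ' 0
    exact weakEquivalence_of_precomp_of_fac e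
  | succ n hn =>
    -- These facets form the horn `Λ[n + 1, 0]`; adding the facet `0`, which meets it in `∂Δ[n]`,
    -- gives the boundary.
    let S : Set (Fin (n + 2)) := {0}ᶜ
    have h₁ : (0 : Fin (n + 2)) ∉ S := by simp [S]
    have h₂ : insert 0 S = Set.univ := by ext; simp [S, em]
    have h₃ : (0 : Fin (n + 2)).succAbove ⁻¹' S = Set.univ := by
      ext; simp [S]
    rw [← facets_univ, ← h₂]
    have sq := isPushout_relativeLatchingMap τ (isPushout_facets S 0 h₁)
      (facets.{w} (n + 1) (insert 0 S)).ι
    have c : Cofibration (relativeLatchingMap τ (facets.{w} n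
        ((0 : Fin (n + 2)).succAbove ⁻¹' S)).ι) := by
      rw [h₃, facets_univ]
      exact hτ n
    have c' : WeakEquivalence (relativeLatchingMap τ (facets.{w} n
        ((0 : Fin (n + 2)).succAbove ⁻¹' S)).ι) := by
      rw [h₃, facets_univ]
      exact hn
    have := weakEquivalence_of_isPushout sq
    have e := relativeLatchingSourceMap_comp τ
        (SSet.Subcomplex.homOfLE (facets_mono (Set.subset_insert 0 S))) (𝟙 _)
        (Category.comp_id
          (SSet.Subcomplex.homOfLE (facets_mono.{w} (Set.subset_insert 0 S)) ≫
            (facets.{w} (n + 1) (insert 0 S)).ι))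
    rw [G.map_id, Category.comp_id] at e
    have hS : S.Nonempty := ⟨1, by simp [S]⟩
    have hS' : S ≠ Set.univ := by
      intro h
      exact h₁ (h ▸ Set.mem_univ _)
    have := cofibration_map_facets F hF.cofibration (n + 1) S
    have := hF.weakEquivalence_facets (n + 1) S hS hS'
    have := hG.weakEquivalence_facets (n + 1) S hS hS'
    have : WeakEquivalence (relativeLatchingMap τ
        (SSet.Subcomplex.homOfLE (facets_mono.{w} (Set.subset_insert 0 S)) ≫
            (facets.{w} (n + 1) (insert 0 S)).ι)) :=
      weakEquivalence_relativeLatchingMap τ (facets.{w} (n + 1) S).ι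
    exact weakEquivalence_of_precomp_of_fac e

end

end Reedy

/-! ### Exchange of lifting properties -/

section Exchange

section

variable {C : Type u} [Category.{w} C] {a b l c t : C} {i : a ⟶ b} {g : a ⟶ l} {inl : b ⟶ c}
  {inr : l ⟶ c} (po : IsPushout i g inl inr) (i' : c ⟶ t)
  {T P H E B : C} {p : E ⟶ B} {h : H ⟶ B} {fst : P ⟶ H} {snd : P ⟶ E}
  (pb : IsPullback fst snd h p) (p' : T ⟶ P)

-- In the application `t` is `F(Δ[m + 1])`, `b` a facet, `l` the complementary horn and `c` the
-- boundary. The lift `y` solves the problem except in `E`, where `y ≫ p' ≫ snd` and `x ≫ snd` agree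
-- only on `a` and over `B`. Lifting `i'` against `p` replaces the extension `e` of the former by a
-- filler `e'` which restricts to the latter on `b` and is unchanged on `l`; lifting `inr ≫ i'`
-- against `p'` carries the correction up to `T`.
include po pb in
lemma hasLiftingProperty_of_exchange_right [HasLiftingProperty (inl ≫ i') (p' ≫ snd)]
    [HasLiftingProperty (inr ≫ i') p'] [HasLiftingProperty i (p' ≫ fst)]
    (hext : ∀ e : b ⟶ E, ∃ e' : t ⟶ E, (inl ≫ i') ≫ e' = e)
    [HasLiftingProperty i' p] : HasLiftingProperty i p' where
  sq_hasLift {f x} sq := by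
    have sq₁ : CommSq f i (p' ≫ fst) (x ≫ fst) := ⟨by rw [← Category.assoc, sq.w, Category.assoc]⟩
    let y := sq₁.lift
    obtain ⟨e, he⟩ := hext (y ≫ p' ≫ snd)
    have w₁ : i ≫ x ≫ snd = g ≫ inr ≫ i' ≫ e := by
      rw [← po.w_assoc, ← Category.assoc inl, he, sq₁.fac_left_assoc, ← sq.w_assoc]
    have sq₂ : CommSq (po.desc (x ≫ snd) (inr ≫ i' ≫ e) w₁) i' p (e ≫ p) := ⟨by
      apply po.hom_ext
      · rw [po.inl_desc_assoc, ← Category.assoc inl, ← Category.assoc (inl ≫ i'), he]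
        have := sq₁.fac_right =≫ h
        simp only [Category.assoc] at this
        simp only [Category.assoc, ← pb.w]
        exact this.symm
      · rw [po.inr_desc_assoc, Category.assoc, Category.assoc]⟩
    let e' := sq₂.lift
    have sq₃ : CommSq y (inl ≫ i') (p' ≫ snd) e := ⟨he.symm⟩
    let ε := sq₃.lift
    have he₁ : inl ≫ i' ≫ e' = x ≫ snd := by rw [sq₂.fac_left, po.inl_desc]
    have he₂ : inr ≫ i' ≫ e' = inr ≫ i' ≫ e := by rw [sq₂.fac_left, po.inr_desc]
    have hε : ε ≫ p' ≫ snd = e := sq₃.fac_right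
    have hε' : inl ≫ i' ≫ ε = y := by rw [← Category.assoc]; exact sq₃.fac_left
    have w₂ : (ε ≫ p' ≫ fst) ≫ h = e' ≫ p := by
      rw [sq₂.fac_right, ← hε]
      simp only [Category.assoc, pb.w]
    have sq₄ : CommSq ((inr ≫ i') ≫ ε) (inr ≫ i') p' (pb.lift _ _ w₂) := ⟨by
      apply pb.hom_ext
      · simp only [Category.assoc, pb.lift_fst]
      · simp only [Category.assoc, pb.lift_snd, hε, he₂]⟩
    have h₁ : inr ≫ i' ≫ sq₄.lift = inr ≫ i' ≫ ε := by
      simpa only [Category.assoc] using sq₄.fac_left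
    refine ⟨⟨⟨inl ≫ i' ≫ sq₄.lift, ?_, ?_⟩⟩⟩
    · rw [po.w_assoc, h₁, ← po.w_assoc, hε']
      exact sq₁.fac_left
    · rw [Category.assoc, Category.assoc, sq₄.fac_right]
      apply pb.hom_ext
      · rw [Category.assoc, Category.assoc, pb.lift_fst, reassoc_of% hε']
        exact sq₁.fac_right
      · rw [Category.assoc, Category.assoc, pb.lift_snd, he₁]

-- Here `T` plays the part of a path object. The map `e` is right on `l`, while on `b` it may differ
-- from `f`. Lifting `i` against `p'` gives maps `y` and `y'` to `T` over these two values, which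
-- agree on `a` and after `p' ≫ fst`. Lifting `i'` against `p' ≫ fst` then spreads `y'` over `t`.
include po pb in
lemma hasLiftingProperty_of_exchange_left [HasLiftingProperty (inl ≫ i') (p' ≫ snd)]
    [HasLiftingProperty i' (p' ≫ fst)] [HasLiftingProperty (inr ≫ i') p]
    (hlift : ∀ e : b ⟶ E, ∃ e' : b ⟶ T, e' ≫ p' ≫ snd = e)
    [HasLiftingProperty i p'] : HasLiftingProperty i' p where
  sq_hasLift {f z} sq := by
    have sq₁ : CommSq (inr ≫ f) (inr ≫ i') p z := ⟨by
      rw [Category.assoc, Category.assoc, sq.w]⟩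
    let e := sq₁.lift
    have he₁ : inr ≫ i' ≫ e = inr ≫ f := by
      rw [← Category.assoc]; exact sq₁.fac_left
    have he₂ : e ≫ p = z := sq₁.fac_right
    obtain ⟨y, hy⟩ := hlift (inl ≫ i' ≫ e)
    have w₁ : (y ≫ p' ≫ fst) ≫ h = (inl ≫ f) ≫ p := by
      have := hy =≫ p
      simp only [Category.assoc, he₂, pb.w] at this ⊢
      rw [this, sq.w]
    have sq₂ : CommSq (i ≫ y) i p' (pb.lift _ _ w₁) := ⟨by
      apply pb.hom_ext
      · simp only [Category.assoc, pb.lift_fst]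
      · simp only [Category.assoc, pb.lift_snd, hy]
        rw [po.w_assoc, po.w_assoc, he₁]⟩
    let y' := sq₂.lift
    have hy₁ : i ≫ y' = i ≫ y := sq₂.fac_left
    have hy₂ : y' ≫ p' ≫ fst = y ≫ p' ≫ fst := by
      have := sq₂.fac_right =≫ fst
      rwa [Category.assoc, pb.lift_fst] at this
    have hy₃ : y' ≫ p' ≫ snd = inl ≫ f := by
      have := sq₂.fac_right =≫ snd
      rwa [Category.assoc, pb.lift_snd] at this
    have sq₃ : CommSq y (inl ≫ i') (p' ≫ snd) e := ⟨by rw [hy, Category.assoc]⟩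
    let ε := sq₃.lift
    have hε : ε ≫ p' ≫ snd = e := sq₃.fac_right
    have hε' : inl ≫ i' ≫ ε = y := by rw [← Category.assoc]; exact sq₃.fac_left
    have w₂ : i ≫ y' = g ≫ inr ≫ i' ≫ ε := by rw [hy₁, ← po.w_assoc, hε']
    have sq₄ : CommSq (po.desc y' (inr ≫ i' ≫ ε) w₂) i' (p' ≫ fst) (ε ≫ p' ≫ fst) := ⟨by
      apply po.hom_ext
      · rw [po.inl_desc_assoc, hy₂, reassoc_of% hε']
      · rw [po.inr_desc_assoc, Category.assoc, Category.assoc]⟩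
    refine ⟨⟨⟨sq₄.lift ≫ p' ≫ snd, ?_, ?_⟩⟩⟩
    · rw [sq₄.fac_left_assoc]
      apply po.hom_ext
      · rw [po.inl_desc_assoc, hy₃]
      · rw [po.inr_desc_assoc, Category.assoc, Category.assoc, hε, he₁]
    · have := sq₄.fac_right =≫ h
      simp only [Category.assoc, pb.w] at this
      rw [Category.assoc, Category.assoc, this, ← he₂, ← hε]
      simp only [Category.assoc]

end

variable {C : Type u} [Category.{w} C] [ModelCategory C]

lemma IsReedyCofibrantConstant.cofibration_δ {D : Type u} [Category.{w} D] [ModelCategory D]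
    {F : SSet.{w} ⥤ D} (hF : IsReedyCofibrantConstant F) {n : ℕ} (i : Fin (n + 2)) :
    Cofibration (F.map (SSet.stdSimplex.map (SimplexCategory.δ i))) := by
  have := hF.isLeftAdjoint
  have := isIso_facetMap_singleton.{w} i
  have := cofibration_map_facets F hF.cofibration (n + 1) (insert i ∅)
  have e : F.map (SSet.stdSimplex.map (SimplexCategory.δ i)) =
      F.map (facetMap.{w} (Set.mem_insert i ∅)) ≫ F.map (facets.{w} (n + 1) (insert i ∅)).ι := by
    rw [← F.map_comp]
    rfl
  rw [e]
  infer_instance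

lemma IsReedyCofibrantConstant.isCofibrant {D : Type u} [Category.{w} D] [ModelCategory D]
    {F : SSet.{w} ⥤ D} (hF : IsReedyCofibrantConstant F) (n : ℕ) :
    IsCofibrant (F.obj Δ[n]) := by
  have := hF.isLeftAdjoint
  have h := cofibration_map_facets F hF.cofibration n ∅
  rw [facets_empty] at h
  rwa [isCofibrant_iff_of_isInitial (F.map (⊥ : (Δ[n] : SSet.{w}).Subcomplex).ι)
    (SSet.Subcomplex.isInitialBot.isInitialObj F)]

/-- For a Reedy cofibrant homotopically constant `F` and a Reedy fibration between Reedy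
fibrant homotopically constant simplicial objects, raising the degree of the latching map
of `F` amounts to raising the degree of the relative matching map. -/
lemma hasLiftingProperty_latching_succ_iff {F : SSet.{w} ⥤ C} {G G' : SSet.{w} ⥤ Cᵒᵖ}
    (τ : G ⟶ G') (hF : IsReedyCofibrantConstant F) (hG : IsReedyCofibrantConstant G)
    (hG' : IsReedyCofibrantConstant G')
    (hτ : ∀ n : ℕ, Cofibration (relativeLatchingMap τ (SSet.boundary.{w} n).ι))
    (hC : ∀ X : C, IsFibrant X) (m n : ℕ) :
    HasLiftingProperty (F.map (SSet.boundary.{w} (m + 1)).ι)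
      (relativeLatchingMap τ (SSet.boundary.{w} n).ι).unop ↔
    HasLiftingProperty (F.map (SSet.boundary.{w} m).ι)
      (relativeLatchingMap τ (SSet.boundary.{w} (n + 1)).ι).unop := by
  have := hF.isLeftAdjoint
  have := hG.isLeftAdjoint
  have := hG'.isLeftAdjoint
  -- On both sides the boundary is split into the facet `0` and the horn `Λ[k + 1, 0]`, which meet
  -- in `∂Δ[k]`.
  have h₁ (k : ℕ) : (0 : Fin (k + 2)) ∉ ({0}ᶜ : Set (Fin (k + 2))) := by simp
  have h₂ (k : ℕ) : insert 0 ({0}ᶜ : Set (Fin (k + 2))) = Set.univ := by ext; simp [em]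
  have h₃ (k : ℕ) : (0 : Fin (k + 2)).succAbove ⁻¹' ({0}ᶜ : Set (Fin (k + 2))) = Set.univ := by
    ext; simp
  have h₄ (k : ℕ) : ({0}ᶜ : Set (Fin (k + 2))).Nonempty := ⟨1, by simp⟩
  have h₅ (k : ℕ) : ({0}ᶜ : Set (Fin (k + 2))) ≠ Set.univ := fun h ↦
    h₁ k (h ▸ Set.mem_univ _)
  rw [← facets_univ (m + 1), ← facets_univ (n + 1), ← h₂ m, ← h₂ n, ← facets_univ m,
    ← facets_univ n, ← h₃ m, ← h₃ n]
  have po := (isPushout_facets _ _ (h₁ m)).map F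
  have pb := (isPushout_relativeLatchingMap τ (isPushout_facets _ _ (h₁ n))
    (facets.{w} (n + 1) (insert 0 {0}ᶜ)).ι).unop
  have cτ := cofibration_relativeLatchingMap_facets τ hτ
  have cF := cofibration_map_facets F hF.cofibration
  have cG := cofibration_map_facets G hG.cofibration
  have wF := hF.weakEquivalence_facets (m + 1) {0}ᶜ (h₄ m) (h₅ m)
  have wG := hG.weakEquivalence_facets (n + 1) {0}ᶜ (h₄ n) (h₅ n)
  have wG' := hG'.weakEquivalence_facets (n + 1) {0}ᶜ (h₄ n) (h₅ n)
  have wτ : WeakEquivalence (relativeLatchingMap τ (facets.{w} (n + 1) {0}ᶜ).ι) :=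
    weakEquivalence_relativeLatchingMap τ (facets.{w} (n + 1) {0}ᶜ).ι
  -- The auxiliary lifting properties are automatic: `F` sends cofaces and horn inclusions to
  -- trivial cofibrations, and dually the coface and the horn give trivial fibrations on the
  -- simplicial side.
  have tF : HasLiftingProperty (F.map (SSet.stdSimplex.map (SimplexCategory.δ (0 : Fin (m + 2)))))
      (G'.map (SSet.stdSimplex.map (SimplexCategory.δ (0 : Fin (n + 2))))).unop := by
    have := hF.cofibration_δ (0 : Fin (m + 2))
    have := hF.weakEquivalence (SimplexCategory.δ (0 : Fin (m + 2)))
    have := hG'.cofibration_δ (0 : Fin (n + 2))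
    infer_instance
  have ev : F.map (facetMap.{w} (Set.mem_insert 0 {0}ᶜ)) ≫
      F.map (facets.{w} (m + 1) (insert 0 {0}ᶜ)).ι =
        F.map (SSet.stdSimplex.map (SimplexCategory.δ (0 : Fin (m + 2)))) := by
    rw [← F.map_comp]
    rfl
  have ek : F.map (SSet.Subcomplex.homOfLE
      (facets_mono.{w} (Set.subset_insert 0 ({0}ᶜ : Set (Fin (m + 2)))))) ≫
        F.map (facets.{w} (m + 1) (insert 0 {0}ᶜ)).ι = F.map (facets.{w} (m + 1) {0}ᶜ).ι := by
    rw [← F.map_comp]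
    rfl
  have ed : (relativeLatchingMap τ (facets.{w} (n + 1) (insert 0 {0}ᶜ)).ι).unop ≫
      (G'.map (facetMap.{w} (Set.mem_insert 0 {0}ᶜ)) ≫
        pushout.inr (G.map (facets.{w} (n + 1) (insert 0 {0}ᶜ)).ι) (τ.app _)).unop =
      (G'.map (SSet.stdSimplex.map (SimplexCategory.δ (0 : Fin (n + 2))))).unop := by
    rw [← unop_comp, Category.assoc, inr_relativeLatchingMap, ← G'.map_comp]
    rfl
  have eπ : (relativeLatchingMap τ (facets.{w} (n + 1) (insert 0 {0}ᶜ)).ι).unop ≫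
      (relativeLatchingSourceMap τ (i := SSet.Subcomplex.homOfLE
          (facets_mono.{w} (Set.subset_insert 0 ({0}ᶜ : Set (Fin (n + 2))))) ≫
          (facets.{w} (n + 1) (insert 0 {0}ᶜ)).ι)
        (i' := (facets.{w} (n + 1) (insert 0 {0}ᶜ)).ι) (SSet.Subcomplex.homOfLE
          (facets_mono.{w} (Set.subset_insert 0 ({0}ᶜ : Set (Fin (n + 2))))))
        (𝟙 _) (Category.comp_id _)).unop =
      (relativeLatchingMap τ (SSet.Subcomplex.homOfLE
          (facets_mono.{w} (Set.subset_insert 0 ({0}ᶜ : Set (Fin (n + 2))))) ≫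
          (facets.{w} (n + 1) (insert 0 {0}ᶜ)).ι)).unop := by
    rw [← unop_comp, relativeLatchingSourceMap_comp, G'.map_id, Category.comp_id]
  have := cF (m + 1) {0}ᶜ
  have := cτ (n + 1) {0}ᶜ
  have := cτ (n + 1) (insert 0 {0}ᶜ)
  have := cτ n ((0 : Fin (n + 2)).succAbove ⁻¹' {0}ᶜ)
  have := cF m ((0 : Fin (m + 2)).succAbove ⁻¹' {0}ᶜ)
  have := cF (m + 1) (insert 0 {0}ᶜ)
  rw [← ev, ← ed] at tF
  have t₁ : HasLiftingProperty (F.map (facets.{w} (m + 1) {0}ᶜ).ι)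
    (relativeLatchingMap τ (facets.{w} (n + 1) (insert 0 {0}ᶜ)).ι).unop := inferInstance
  have t₂ : HasLiftingProperty (F.map (facets.{w} m ((0 : Fin (m + 2)).succAbove ⁻¹' {0}ᶜ)).ι)
    (relativeLatchingMap τ (facets.{w} (n + 1) {0}ᶜ).ι).unop := inferInstance
  have t₃ : HasLiftingProperty (F.map (facets.{w} (m + 1) {0}ᶜ).ι)
    (relativeLatchingMap τ (facets.{w} n ((0 : Fin (n + 2)).succAbove ⁻¹' {0}ᶜ)).ι).unop :=
    inferInstance
  have t₄ : HasLiftingProperty (F.map (facets.{w} (m + 1) (insert 0 {0}ᶜ)).ι)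
    (relativeLatchingMap τ (facets.{w} (n + 1) {0}ᶜ).ι).unop := inferInstance
  rw [← ek] at t₁ t₃
  replace t₂ := Eq.mpr (congrArg (HasLiftingProperty _) eπ) t₂
  replace t₄ := Eq.mpr (congrArg (HasLiftingProperty _) eπ) t₄
  constructor
  · intro hlp
    refine hasLiftingProperty_of_exchange_right po (F.map (facets.{w} (m + 1) (insert 0 {0}ᶜ)).ι) pb
      (relativeLatchingMap τ (facets.{w} (n + 1) (insert 0 {0}ᶜ)).ι).unop (fun e ↦ ?_)
    -- Extending `e` along a trivial cofibration uses that its target is fibrant.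
    have := hF.cofibration_δ (0 : Fin (m + 2))
    have := hF.weakEquivalence (SimplexCategory.δ (0 : Fin (m + 2)))
    have := hC (G'.obj Δ[n]).unop
    have sq : CommSq e (F.map (SSet.stdSimplex.map (SimplexCategory.δ (0 : Fin (m + 2)))))
      (terminal.from (G'.obj Δ[n]).unop) (terminal.from _) := ⟨Subsingleton.elim _ _⟩
    exact ⟨sq.lift, by rw [ev]; exact sq.fac_left⟩
  · intro hlp
    refine hasLiftingProperty_of_exchange_left po (F.map (facets.{w} (m + 1) (insert 0 {0}ᶜ)).ι) pb
      (relativeLatchingMap τ (facets.{w} (n + 1) (insert 0 {0}ᶜ)).ι).unop (fun e ↦ ?_)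
    have := hG'.cofibration_δ (0 : Fin (n + 2))
    have := hG'.weakEquivalence (SimplexCategory.δ (0 : Fin (n + 2)))
    have := hF.isCofibrant m
    have sq : CommSq (initial.to _) (initial.to (F.obj Δ[m]))
      (G'.map (SSet.stdSimplex.map (SimplexCategory.δ (0 : Fin (n + 2))))).unop e :=
      ⟨Subsingleton.elim _ _⟩
    exact ⟨sq.lift, by rw [ed]; exact sq.fac_right⟩

/-- The total degree `m + k` is constant under the exchange, so all of `n` can be moved from the
latching side to the matching side. -/
lemma hasLiftingProperty_latching_iff {F : SSet.{w} ⥤ C} {G G' : SSet.{w} ⥤ Cᵒᵖ}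
    (τ : G ⟶ G') (hF : IsReedyCofibrantConstant F) (hG : IsReedyCofibrantConstant G)
    (hG' : IsReedyCofibrantConstant G')
    (hτ : ∀ n : ℕ, Cofibration (relativeLatchingMap τ (SSet.boundary.{w} n).ι))
    (hC : ∀ X : C, IsFibrant X) (n : ℕ) :
    HasLiftingProperty (F.map (SSet.boundary.{w} n).ι)
      (relativeLatchingMap τ (SSet.boundary.{w} 0).ι).unop ↔
    HasLiftingProperty (F.map (SSet.boundary.{w} 0).ι)
      (relativeLatchingMap τ (SSet.boundary.{w} n).ι).unop := by
  suffices ∀ m k : ℕ, HasLiftingProperty (F.map (SSet.boundary.{w} (m + k)).ι)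
      (relativeLatchingMap τ (SSet.boundary.{w} 0).ι).unop ↔
      HasLiftingProperty (F.map (SSet.boundary.{w} m).ι)
        (relativeLatchingMap τ (SSet.boundary.{w} k).ι).unop by
    have := this 0 n
    rwa [zero_add] at this
  intro m k
  induction k generalizing m with
  | zero => rfl
  | succ k hk =>
    rw [← hasLiftingProperty_latching_succ_iff τ hF hG hG' hτ hC m k, ← hk (m + 1),
      show m + (k + 1) = m + 1 + k by lia]

end Exchange

/-! ### Copowers and cotensors by simplicial sets -/

section Copower

variable {C : Type u} [Category.{w} C]

section

variable [HasColimits C]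

/-- The copower `L ⊙ b` of an object `b` by a simplicial set `L`. -/
def copower : SSet.{w} ⥤ C ⥤ SimplexCategoryᵒᵖ ⥤ C where
  obj L :=
    { obj b := L ⋙ sigmaConst.obj b
      map j := Functor.whiskerLeft L (sigmaConst.map j) }
  map i :=
    { app b := Functor.whiskerRight i (sigmaConst.obj b)
      naturality b b' j := by
        ext m
        apply Sigma.hom_ext
        intro x
        simp }

/-- The inclusion of the summand of `(L ⊙ b)_m` which corresponds to an `m`-simplex of `L`. -/
def copowerι {L : SSet.{w}} (b : C) {m : SimplexCategoryᵒᵖ} (x : L.obj m) :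
    b ⟶ ((copower.obj L).obj b).obj m :=
  Sigma.ι (fun _ : L.obj m ↦ b) x

lemma copowerι_map {L : SSet.{w}} (b : C) {m m' : SimplexCategoryᵒᵖ} (x : L.obj m) (g : m ⟶ m') :
    copowerι b x ≫ ((copower.obj L).obj b).map g = copowerι b (L.map g x) := by
  refine (Sigma.ι_comp_map' _ _ _).trans ?_
  exact Category.id_comp _

lemma copowerι_obj_map_app {L : SSet.{w}} {b b' : C} (j : b ⟶ b') {m : SimplexCategoryᵒᵖ}
    (x : L.obj m) : copowerι b x ≫ ((copower.obj L).map j).app m = j ≫ copowerι b' x :=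
  Sigma.ι_map (fun _ : L.obj m ↦ j) x

lemma copowerι_map_app_app {L L' : SSet.{w}} (i : L ⟶ L') (b : C) {m : SimplexCategoryᵒᵖ}
    (x : L.obj m) : copowerι b x ≫ ((copower.map i).app b).app m = copowerι b (i.app m x) := by
  refine (Sigma.ι_comp_map' _ _ _).trans ?_
  exact Category.id_comp _

lemma copower_hom_ext {L : SSet.{w}} {b X : C} {m : SimplexCategoryᵒᵖ}
    {f g : ((copower.obj L).obj b).obj m ⟶ X}
    (h : ∀ x : L.obj m, copowerι b x ≫ f = copowerι b x ≫ g) : f = g :=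
  Sigma.hom_ext _ _ h

/-- Constructor for morphisms from the levels of `L ⊙ b`. -/
def copowerDesc {L : SSet.{w}} {b X : C} {m : SimplexCategoryᵒᵖ} (f : L.obj m → (b ⟶ X)) :
    ((copower.obj L).obj b).obj m ⟶ X :=
  Sigma.desc f

lemma copowerι_copowerDesc {L : SSet.{w}} {b X : C} {m : SimplexCategoryᵒᵖ}
    (f : L.obj m → (b ⟶ X)) (x : L.obj m) : copowerι b x ≫ copowerDesc f = f x :=
  Sigma.ι_desc _ _

lemma hasLiftingProperty_copower_iff {K L : SSet.{w}} (i : K ⟶ L) (X : C)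
    {Y Z : SimplexCategoryᵒᵖ ⥤ C} (p : Y ⟶ Z) :
    HasLiftingProperty ((copower.map i).app X) p ↔ HasLiftingProperty i (homComplexMap X p) :=
  ((sigmaConstAdj X).whiskerRight SimplexCategoryᵒᵖ).hasLiftingProperty_iff i p

/-- The pushout-corner map `(K ⊙ b) ∪ (L ⊙ a) ⟶ L ⊙ b` of `i : K ⟶ L` and `j : a ⟶ b`. -/
def copowerCorner {K L : SSet.{w}} (i : K ⟶ L) {a b : C} (j : a ⟶ b) :=
  (Functor.PushoutObjObj.ofHasPushout copower i j).ι

/-- In each level `L` splits as `K` and a complement, so the corner map is a sum of copies of `j`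
indexed by the complement and of identities. -/
lemma hasLiftingProperty_copowerCorner_app {K L : SSet.{w}} (i : K ⟶ L) [Mono i] {a b : C}
    (j : a ⟶ b) (m : SimplexCategoryᵒᵖ) {X Y : C} (f : X ⟶ Y) [HasLiftingProperty j f] :
    HasLiftingProperty ((copowerCorner i j).app m) f where
  sq_hasLift {u v} sq := by
    let S := Functor.PushoutObjObj.ofHasPushout copower i j
    have po : IsPushout (((copower.map i).app a).app m) (((copower.obj K).map j).app m)
      (S.inl.app m) (S.inr.app m) := S.isPushout.map ((evaluation _ _).obj m)
    have e₁ : S.inl.app m ≫ (copowerCorner i j).app m = ((copower.obj L).map j).app m :=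
      NatTrans.congr_app S.inl_ι m
    have e₂ : S.inr.app m ≫ (copowerCorner i j).app m = ((copower.map i).app b).app m :=
      NatTrans.congr_app S.inr_ι m
    have hi : Function.Injective (i.app m) := by
      rw [← mono_iff_injective]
      infer_instance
    have sq' (x : L.obj m) : CommSq (copowerι a x ≫ S.inl.app m ≫ u) j f (copowerι b x ≫ v) := ⟨by
      rw [Category.assoc, Category.assoc, sq.w, reassoc_of% e₁, ← Category.assoc,
        copowerι_obj_map_app, Category.assoc]⟩
    classical
    -- On simplices from `K` the value is forced by `u`; on the others any lift will do.
    let φ (x : L.obj m) : b ⟶ X :=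
      if h : ∃ y : K.obj m, i.app m y = x then copowerι b h.choose ≫ S.inr.app m ≫ u
      else (sq' x).lift
    have hφ (y : K.obj m) : φ (i.app m y) = copowerι b y ≫ S.inr.app m ≫ u := by
      have h : ∃ z : K.obj m, i.app m z = i.app m y := ⟨y, rfl⟩
      dsimp only [φ]
      rw [dif_pos h, hi h.choose_spec]
    have hφ' (x : L.obj m) (h : ¬ ∃ y : K.obj m, i.app m y = x) : φ x = (sq' x).lift :=
      dif_neg h
    refine ⟨⟨⟨copowerDesc φ, ?_, ?_⟩⟩⟩
    · apply po.hom_ext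
      · apply copower_hom_ext
        intro x
        rw [reassoc_of% e₁, ← Category.assoc, copowerι_obj_map_app, Category.assoc,
          copowerι_copowerDesc]
        by_cases h : ∃ y : K.obj m, i.app m y = x
        · obtain ⟨y, rfl⟩ := h
          rw [hφ, ← Category.assoc, ← copowerι_obj_map_app, Category.assoc, ← po.w_assoc,
            ← Category.assoc, copowerι_map_app_app]
        · rw [hφ' x h, (sq' x).fac_left]
      · apply copower_hom_ext
        intro x
        rw [reassoc_of% e₂, ← Category.assoc, copowerι_map_app_app, copowerι_copowerDesc, hφ]
    · apply copower_hom_ext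
      intro x
      rw [← Category.assoc, copowerι_copowerDesc]
      by_cases h : ∃ y : K.obj m, i.app m y = x
      · obtain ⟨y, rfl⟩ := h
        rw [hφ, Category.assoc, Category.assoc, sq.w, reassoc_of% e₂, ← Category.assoc,
          copowerι_map_app_app]
      · rw [hφ' x h, (sq' x).fac_right]

end

/-! ### Cotensors of simplicial objects, as tensors in the opposite category. -/

section

variable [HasLimits C]

lemma tensorTransApp_id {D : Type u} [Category.{w} D] [HasColimits D] (A : SimplexCategory ⥤ D)
    (L : SSet.{w}) : tensorTransApp (𝟙 A) L = 𝟙 _ := by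
  apply tensorObj_hom_ext
  intro m x
  rw [tensorι_tensorTransApp, NatTrans.id_app, Category.id_comp, Category.comp_id]

lemma tensorTransApp_comp {D : Type u} [Category.{w} D] [HasColimits D]
    {A A' A'' : SimplexCategory ⥤ D} (τ : A ⟶ A') (τ' : A' ⟶ A'') (L : SSet.{w}) :
    tensorTransApp (τ ≫ τ') L = tensorTransApp τ L ≫ tensorTransApp τ' L := by
  apply tensorObj_hom_ext
  intro m x
  rw [tensorι_tensorTransApp, tensorι_tensorTransApp_assoc, tensorι_tensorTransApp,
    NatTrans.comp_app, Category.assoc]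

/-- The cotensor `Y ^ L` of a simplicial object `Y` by a simplicial set `L`. -/
def cotensor : SSet.{w}ᵒᵖ ⥤ (SimplexCategoryᵒᵖ ⥤ C) ⥤ C where
  obj L :=
    { obj Y := (tensorObj Y.rightOp L.unop).unop
      map p := (tensorTransApp (NatTrans.rightOp p) L.unop).unop
      map_id Y := congrArg Quiver.Hom.unop (tensorTransApp_id Y.rightOp L.unop)
      map_comp p q := congrArg Quiver.Hom.unop
        (tensorTransApp_comp (NatTrans.rightOp q) (NatTrans.rightOp p) L.unop) }
  map i :=
    { app Y := (tensorMap Y.rightOp i.unop).unop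
      naturality Y Y' p := congrArg Quiver.Hom.unop
        (tensorMap_tensorTransApp (NatTrans.rightOp p) i.unop) }
  map_id L := by
    ext Y
    exact congrArg Quiver.Hom.unop ((tensorFunctor Y.rightOp).map_id L.unop)
  map_comp i j := by
    ext Y
    exact congrArg Quiver.Hom.unop ((tensorFunctor Y.rightOp).map_comp j.unop i.unop)

/-- The projection `Y ^ L ⟶ Y_m` which corresponds to a simplex `Δ[m] ⟶ L`. -/
def cotensorπ (Y : SimplexCategoryᵒᵖ ⥤ C) {L : SSet.{w}} {m : SimplexCategoryᵒᵖ} (x : L.obj m) :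
    (cotensor.obj (op L)).obj Y ⟶ Y.obj m :=
  (tensorι Y.rightOp (L := L) (m := m.unop) (SSet.yonedaEquiv.symm x)).unop

lemma cotensorπ_map (Y : SimplexCategoryᵒᵖ ⥤ C) {L : SSet.{w}} {m m' : SimplexCategoryᵒᵖ}
    (x : L.obj m) (g : m ⟶ m') :
    cotensorπ Y x ≫ Y.map g = cotensorπ Y (L.map g x) := by
  refine congrArg Quiver.Hom.unop ((map_tensorι Y.rightOp g.unop _).trans ?_)
  exact congrArg (tensorι Y.rightOp) (map_comp_yonedaEquiv_symm g.unop x)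

lemma cotensor_hom_ext {b : C} {Y : SimplexCategoryᵒᵖ ⥤ C} {L : SSet.{w}}
    {f g : b ⟶ (cotensor.obj (op L)).obj Y}
    (h : ∀ (m : SimplexCategoryᵒᵖ) (x : L.obj m), f ≫ cotensorπ Y x = g ≫ cotensorπ Y x) :
    f = g := by
  refine Quiver.Hom.op_inj (tensorObj_hom_ext (A := Y.rightOp) fun m x ↦ ?_)
  have := h (op m) (SSet.yonedaEquiv x)
  rw [cotensorπ, Equiv.symm_apply_apply] at this
  exact congrArg Quiver.Hom.op this

lemma obj_map_cotensorπ {Y Y' : SimplexCategoryᵒᵖ ⥤ C} (p : Y ⟶ Y') {L : SSet.{w}}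
    {m : SimplexCategoryᵒᵖ} (x : L.obj m) :
    (cotensor.obj (op L)).map p ≫ cotensorπ Y' x = cotensorπ Y x ≫ p.app m :=
  congrArg Quiver.Hom.unop (tensorι_tensorTransApp (NatTrans.rightOp p) _)

lemma map_app_cotensorπ (Y : SimplexCategoryᵒᵖ ⥤ C) {L L' : SSet.{w}} (i : L ⟶ L')
    {m : SimplexCategoryᵒᵖ} (x : L.obj m) :
    (cotensor.map i.op).app Y ≫ cotensorπ Y x = cotensorπ Y (i.app m x) := by
  refine congrArg Quiver.Hom.unop ((tensorι_tensorMap Y.rightOp _ i).trans ?_)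
  refine congrArg (tensorι Y.rightOp) (SSet.yonedaEquiv.injective ?_)
  rw [Equiv.apply_symm_apply]
  exact congrArg (i.app m) (SSet.yonedaEquiv.apply_symm_apply x)

end

variable [HasLimits C] [HasColimits C]

/-- The map `L ⟶ C(b, Y_•)` attached to `L ⊙ b ⟶ Y`. -/
def copowerToSingular {L : SSet.{w}} {b : C} {Y : SimplexCategoryᵒᵖ ⥤ C}
    (f : (copower.obj L).obj b ⟶ Y) : L ⟶ (singular Y.rightOp).obj (op b) where
  app m := ↾fun x ↦ (copowerι b x ≫ f.app m).op
  naturality m m' g := by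
    ext x
    refine congrArg Quiver.Hom.op ?_
    change copowerι b (L.map g x) ≫ f.app m' = (copowerι b x ≫ f.app m) ≫ Y.map g
    rw [Category.assoc, ← f.naturality, ← Category.assoc, copowerι_map]

/-- Constructor for morphisms to `Y ^ L`. -/
def cotensorLift {L : SSet.{w}} {b : C} {Y : SimplexCategoryᵒᵖ ⥤ C}
    (f : (copower.obj L).obj b ⟶ Y) : b ⟶ (cotensor.obj (op L)).obj Y :=
  (tensorDesc Y.rightOp (copowerToSingular f)).unop

lemma cotensorLift_cotensorπ {L : SSet.{w}} {b : C} {Y : SimplexCategoryᵒᵖ ⥤ C}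
    (f : (copower.obj L).obj b ⟶ Y) {m : SimplexCategoryᵒᵖ} (x : L.obj m) :
    cotensorLift f ≫ cotensorπ Y x = copowerι b x ≫ f.app m := by
  refine (congrArg Quiver.Hom.unop (tensorι_tensorDesc Y.rightOp (copowerToSingular f)
    (SSet.yonedaEquiv.symm x))).trans ?_
  rw [Equiv.apply_symm_apply]
  rfl

/-- Morphisms `L ⊙ b ⟶ Y` correspond to morphisms `b ⟶ Y ^ L`. -/
def copowerHomEquiv (L : SSet.{w}) (b : C) (Y : SimplexCategoryᵒᵖ ⥤ C) :
    ((copower.obj L).obj b ⟶ Y) ≃ (b ⟶ (cotensor.obj (op L)).obj Y) where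
  toFun f := cotensorLift f
  invFun g :=
    { app m := copowerDesc (fun x ↦ g ≫ cotensorπ Y x)
      naturality m m' h := by
        apply copower_hom_ext
        intro x
        rw [← Category.assoc, copowerι_map, copowerι_copowerDesc, ← Category.assoc,
          copowerι_copowerDesc, Category.assoc, cotensorπ_map] }
  left_inv f := by
    ext m : 2
    apply copower_hom_ext
    intro x
    rw [copowerι_copowerDesc, cotensorLift_cotensorπ]
  right_inv g := by
    apply cotensor_hom_ext
    intro m x
    rw [cotensorLift_cotensorπ, copowerι_copowerDesc]

variable (C) in
/-- The copowers and the cotensors by simplicial sets form an adjunction of two variables. -/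
def copowerAdj : (copower : SSet.{w} ⥤ C ⥤ _) ⊣₂ cotensor :=
  ParametrizedAdjunction.mk' (fun L ↦ Adjunction.mkOfHomEquiv
    { homEquiv := copowerHomEquiv L
      homEquiv_naturality_left_symm {b b' Y} j g := by
        ext m : 2
        apply copower_hom_ext
        intro x
        refine (copowerι_copowerDesc _ _).trans ?_
        rw [NatTrans.comp_app, ← Category.assoc, copowerι_obj_map_app, Category.assoc,
          Category.assoc]
        exact congrArg (j ≫ ·) (copowerι_copowerDesc (fun x ↦ g ≫ cotensorπ Y x) x).symm
      homEquiv_naturality_right f p := by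
        apply cotensor_hom_ext
        intro m x
        rw [Category.assoc, obj_map_cotensorπ, ← Category.assoc]
        refine (cotensorLift_cotensorπ _ _).trans (Eq.trans ?_
          (congrArg (· ≫ p.app m) (cotensorLift_cotensorπ f x)).symm)
        rw [NatTrans.comp_app, Category.assoc] })
    (fun i b Y f ↦ by
      simp only [Adjunction.mkOfHomEquiv_homEquiv]
      apply cotensor_hom_ext
      intro m x
      refine (cotensorLift_cotensorπ _ _).trans ?_
      rw [Category.assoc, map_app_cotensorπ, NatTrans.comp_app, ← Category.assoc,
        copowerι_map_app_app]
      exact (cotensorLift_cotensorπ _ _).symm)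

/-- The relative matching map `Y ^ L ⟶ Y ^ K ×_{Z ^ K} Z ^ L` of a morphism of simplicial objects
`Y ⟶ Z` at a morphism `K ⟶ L`. -/
def relativeMatchingMap {Y Z : SimplexCategoryᵒᵖ ⥤ C} (p : Y ⟶ Z) {K L : SSet.{w}} (i : K ⟶ L) :=
  (relativeLatchingMap (tensorTrans (NatTrans.rightOp p)) i).unop

/-- The relative matching map as a pullback-corner map. -/
def pullbackObjObj {Y Z : SimplexCategoryᵒᵖ ⥤ C} (p : Y ⟶ Z) {K L : SSet.{w}} (i : K ⟶ L) :
    (cotensor (C := C)).PullbackObjObj i p where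
  pt := (pushout ((tensorFunctor Z.rightOp).map i)
    ((tensorTrans (NatTrans.rightOp p)).app K)).unop
  fst := (pushout.inr ((tensorFunctor Z.rightOp).map i)
    ((tensorTrans (NatTrans.rightOp p)).app K)).unop
  snd := (pushout.inl ((tensorFunctor Z.rightOp).map i)
    ((tensorTrans (NatTrans.rightOp p)).app K)).unop
  isPullback := (IsPushout.of_hasPushout ((tensorFunctor Z.rightOp).map i)
    ((tensorTrans (NatTrans.rightOp p)).app K)).unop
  π := relativeMatchingMap p i
  π_fst := congrArg Quiver.Hom.unop
    (inr_relativeLatchingMap (tensorTrans (NatTrans.rightOp p)) i)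
  π_snd := congrArg Quiver.Hom.unop
    (inl_relativeLatchingMap (tensorTrans (NatTrans.rightOp p)) i)

lemma hasLiftingProperty_copowerCorner_iff {K L : SSet.{w}} (i : K ⟶ L) {a b : C} (j : a ⟶ b)
    {Y Z : SimplexCategoryᵒᵖ ⥤ C} (p : Y ⟶ Z) :
    HasLiftingProperty (copowerCorner i j) p ↔ HasLiftingProperty j (relativeMatchingMap p i) :=
  (copowerAdj C).hasLiftingProperty_iff _ (pullbackObjObj p i)


/-- For `∅ ⟶ X` the pushout-corner map degenerates to the copower of `i` with `X`. Hence lifting in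
`C(X, p)` is the two-variable adjunction applied to `∅ ⟶ X`. -/
lemma hasLiftingProperty_homComplexMap_iff {K L : SSet.{w}} (i : K ⟶ L) (X : C)
    {Y Z : SimplexCategoryᵒᵖ ⥤ C} (p : Y ⟶ Z) :
    HasLiftingProperty i (homComplexMap X p) ↔
      HasLiftingProperty (initial.to X) (relativeMatchingMap p i) := by
  have h (L : SSet.{w}) : IsInitial ((copower.obj L).obj (⊥_ C)) := by
    have := ((copowerAdj C).adj L).leftAdjoint_preservesColimits
    exact initialIsInitial.isInitialObj (copower.obj L)
  have := isIso_of_isInitial (h K) (h L) ((copower.map i).app (⊥_ C))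
  let sq : copower.PushoutObjObj i (initial.to X) :=
    { pt := (copower.obj K).obj X
      inl := (h L).to _
      inr := 𝟙 _
      isPushout := IsPushout.of_horiz_isIso ⟨(h K).hom_ext _ _⟩
      ι := (copower.map i).app X
      inl_ι := (h L).hom_ext _ _
      inr_ι := Category.id_comp _ }
  rw [← hasLiftingProperty_copower_iff]
  exact (copowerAdj C).hasLiftingProperty_iff sq (pullbackObjObj p i)

end Copower

/-! ### The small object argument in locally presentable categories -/

section SmallObject

/-- Every object is presentable, and a small family of sources admits a common regular cardinal. -/
lemma hasSmallObjectArgument_of_isLocallyPresentable {D : Type u} [Category.{w} D]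
    [IsLocallyPresentable.{w} D] (W : MorphismProperty D) [MorphismProperty.IsSmall.{w} W] :
    MorphismProperty.HasSmallObjectArgument.{w} W := by
  have : HasColimitsOfSize.{w, w} D := by
    obtain ⟨κ, _, _⟩ := IsLocallyPresentable.exists_cardinal.{w} D
    infer_instance
  obtain ⟨ι, A, B, f, rfl⟩ := (MorphismProperty.isSmall_iff_eq_ofHoms.{w} W).1 inferInstance
  have h (i : ι) : IsPresentable.{w} (A i) := inferInstance
  choose κ' hκ' hκ'' using fun i ↦ (h i).exists_cardinal
  obtain ⟨κ, hκ, h⟩ := HasCardinalLT.exists_regular_cardinal_forall.{w} (fun i ↦ (κ' i).out)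
  have : Fact κ.IsRegular := ⟨hκ⟩
  have : Nonempty κ.ord.ToType := by simpa using hκ.ne_zero
  let _ := WellFoundedLT.toOrderBot κ.ord.ToType
  refine ⟨κ, inferInstance, inferInstance, { preservesColimit := ?_ }⟩
  rintro _ _ X Y _ ⟨i⟩ f hf
  have hi : κ' i ≤ κ := by
    have := (h i).le
    simpa using this
  have : IsCardinalPresentable (A i) κ := by
    have : IsCardinalPresentable (A i) (κ' i) := hκ'' i
    exact isCardinalPresentable_of_le _ hi
  have := preservesColimitsOfShape_of_isCardinalPresentable (A i) κ κ.ord.ToType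
  infer_instance

/-- The simplex category lives in universe `0`; it is lifted so that its objects and morphisms are
in universe `w`. -/
lemma isLocallyPresentable_simplicialObject (C : Type u) [Category.{w} C] [HasPullbacks C]
    [IsLocallyPresentable.{w} C] : IsLocallyPresentable.{w} (SimplexCategoryᵒᵖ ⥤ C) := by
  let e : ULiftHom.{w} (ULift.{w} SimplexCategory) ≌ SimplexCategory :=
    ULiftHomULiftCategory.equiv.{w, w} SimplexCategory |>.symm
  exact (e.op.congrLeft (E := C)).isLocallyPresentable

lemma isLocallyPresentable_cosimplicialObject (C : Type u) [Category.{w} C] [HasPullbacks C]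
    [IsLocallyPresentable.{w} C] : IsLocallyPresentable.{w} (SimplexCategory ⥤ C) := by
  let e : ULiftHom.{w} (ULift.{w} SimplexCategoryᵒᵖ) ≌ SimplexCategoryᵒᵖ :=
    ULiftHomULiftCategory.equiv.{w, w} SimplexCategoryᵒᵖ |>.symm
  exact ((e.op.trans (opOpEquivalence _)).congrLeft (E := C)).isLocallyPresentable

end SmallObject

/-! ### Reedy fibrations of simplicial objects -/

section ReedyFibrations

variable (C : Type u) [Category.{w} C] [HasLimits C] [HasColimits C]

section

variable {C}

/-- The morphisms `(∂Δ[n] ⊙ b) ∪ (Δ[n] ⊙ a) ⟶ Δ[n] ⊙ b` for `a ⟶ b` in `W` and `n ≥ 0`. -/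
def reedyCells (W : MorphismProperty C) : MorphismProperty (SimplexCategoryᵒᵖ ⥤ C) :=
  MorphismProperty.ofHoms (fun x : W.toSet × ℕ ↦
    copowerCorner (SSet.boundary.{w} x.2).ι x.1.1.hom)

instance (W : MorphismProperty C) [MorphismProperty.IsSmall.{w} W] :
    MorphismProperty.IsSmall.{w} (reedyCells W) := by
  dsimp only [reedyCells]
  infer_instance

lemma rlp_reedyCells_iff (W : MorphismProperty C) {Y Z : SimplexCategoryᵒᵖ ⥤ C} (p : Y ⟶ Z) :
    (reedyCells W).rlp p ↔ ∀ n : ℕ, W.rlp (relativeMatchingMap p (SSet.boundary.{w} n).ι) := by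
  constructor
  · intro hp n a b j hj
    rw [← hasLiftingProperty_copowerCorner_iff]
    exact hp _ ⟨((⟨Arrow.mk j, hj⟩ : W.toSet), n)⟩
  · rintro hp _ _ _ ⟨j, n⟩
    rw [hasLiftingProperty_copowerCorner_iff]
    exact hp n _ j.2

end

variable [ModelCategory C]

/-- The Reedy fibrations of simplicial objects. -/
def reedyFibrations : MorphismProperty (SimplexCategoryᵒᵖ ⥤ C) :=
  fun _ _ p ↦ ∀ n : ℕ, Fibration (relativeMatchingMap p (SSet.boundary.{w} n).ι)

variable {C}

lemma reedyFibrations_eq_rlp {J : MorphismProperty C} (hJ : J.rlp = fibrations C) :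
    reedyFibrations C = (reedyCells J).rlp := by
  ext Y Z p
  rw [rlp_reedyCells_iff, hJ]
  simp only [← fibration_iff]
  rfl

variable (C) in
lemma reedyFibrations_eq : reedyFibrations C = (reedyCells (trivialCofibrations C)).rlp :=
  reedyFibrations_eq_rlp (by rw [trivialCofibrations_rlp])

instance : (reedyFibrations C).IsStableUnderComposition := by
  rw [reedyFibrations_eq]
  infer_instance

instance : (reedyFibrations C).IsStableUnderBaseChange := by
  rw [reedyFibrations_eq]
  infer_instance

/-- Evaluation at `m` has a right adjoint, so it suffices that this adjoint sends fibrations to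
Reedy fibrations. Transposing back, that amounts to lifting the levels of the generating cells
against fibrations. -/
lemma weakEquivalence_app_of_llp {X Y : SimplexCategoryᵒᵖ ⥤ C} {c : X ⟶ Y}
    (hc : (reedyFibrations C).llp c) (m : SimplexCategoryᵒᵖ) :
    Cofibration (c.app m) ∧ WeakEquivalence (c.app m) := by
  suffices trivialCofibrations C (c.app m) by
    rwa [mem_trivialCofibrations_iff] at this
  rw [← fibrations_llp]
  intro E B f hf
  have := (evaluationAdjunctionLeft C m).hasLiftingProperty_iff c f
  refine this.2 (hc _ ?_)
  rw [reedyFibrations_eq]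
  rintro _ _ _ ⟨j, n⟩
  rw [← (evaluationAdjunctionLeft C m).hasLiftingProperty_iff]
  have : HasLiftingProperty j.1.hom f := by
    obtain ⟨_, _⟩ := (mem_trivialCofibrations_iff _).1 j.2
    rw [← fibration_iff] at hf
    infer_instance
  exact hasLiftingProperty_copowerCorner_app _ _ _ _

/-- Any morphism of simplicial objects factors as a levelwise trivial cofibration which has the
left lifting property with respect to Reedy fibrations, followed by a Reedy fibration. -/
lemma exists_reedy_factorization [IsLocallyPresentable.{w} C] {J : MorphismProperty C}
    [MorphismProperty.IsSmall.{w} J] (hJ : J.rlp = fibrations C)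
    {X Y : SimplexCategoryᵒᵖ ⥤ C} (f : X ⟶ Y) :
    ∃ (Z : SimplexCategoryᵒᵖ ⥤ C) (c : X ⟶ Z) (p : Z ⟶ Y), c ≫ p = f ∧
      (reedyFibrations C).llp c ∧ reedyFibrations C p := by
  have := isLocallyPresentable_simplicialObject C
  have := hasSmallObjectArgument_of_isLocallyPresentable (reedyCells J)
  rw [reedyFibrations_eq_rlp hJ]
  let d := MorphismProperty.factorizationData (reedyCells J).rlp.llp (reedyCells J).rlp f
  exact ⟨d.Z, d.i, d.p, d.fac, d.hi, d.hp⟩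

/-- The comparison between the two descriptions of `Y ^ L`. -/
def cotensorObjIso {D : Type u} [Category.{w} D] [HasLimits D]
    (Y : SimplexCategoryᵒᵖ ⥤ D) (L : SSet.{w}) :
    (tensorObj Y.rightOp L).unop ≅ cotensorObj Y L :=
  (isLimitConeOfCoconeRightOp ((CostructuredArrow.proj simplexFunctor.{w} L).op ⋙ Y)
    (colimit.isColimit
      (CostructuredArrow.proj simplexFunctor.{w} L ⋙ Y.rightOp))).conePointUniqueUpToIso
    (limit.isLimit _)

lemma matchingMap_eq {D : Type u} [Category.{w} D] [HasLimits D]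
    (Y : SimplexCategoryᵒᵖ ⥤ D) (n : ℕ) :
    matchingMap Y n =
      (latchingMap Y.rightOp n).unop ≫ (cotensorObjIso Y (∂Δ[n] : SSet.{w})).hom := by
  apply limit.hom_ext
  intro σ
  refine (limit.lift_π _ _).trans (Eq.trans ?_ (Category.assoc _ _ _).symm)
  refine Eq.trans ?_ (congrArg ((latchingMap Y.rightOp n).unop ≫ ·)
    (IsLimit.conePointUniqueUpToIso_hom_comp _ _ σ)).symm
  have h := colimit.ι_desc (F := CostructuredArrow.proj simplexFunctor.{w}
    (∂Δ[n] : SSet.{w}) ⋙ Y.rightOp)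
    (Cocone.mk (Y.rightOp.obj ⦋n⦌)
      { app σ := Y.rightOp.map (boundaryHom σ)
        naturality σ τ g := ((Y.rightOp.map_comp _ _).symm.trans
          (congrArg Y.rightOp.map (comp_boundaryHom g))).trans (Category.comp_id _).symm }) σ.unop
  exact (congrArg Quiver.Hom.unop h).symm

lemma fibration_comp_iso_iff {D : Type u} [Category.{w} D] [ModelCategory D] {X Y Z : D}
    (f : X ⟶ Y) (e : Y ≅ Z) : Fibration (f ≫ e.hom) ↔ Fibration f := by
  rw [fibration_iff, fibration_iff]
  exact MorphismProperty.cancel_right_of_respectsIso (fibrations D) f e.hom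

lemma cofibration_comp_iso_iff {D : Type u} [Category.{w} D] [ModelCategory D] {X Y Z : D}
    (f : X ⟶ Y) (e : Y ≅ Z) : Cofibration (f ≫ e.hom) ↔ Cofibration f := by
  rw [cofibration_iff, cofibration_iff]
  exact MorphismProperty.cancel_right_of_respectsIso (cofibrations D) f e.hom

lemma cofibration_latchingMap_iff {D : Type u} [Category.{w} D] [HasColimits D]
    [ModelCategory D] (A : SimplexCategory ⥤ D) (n : ℕ) :
    Cofibration (latchingMap A n) ↔ Cofibration (tensorMap A (SSet.boundary.{w} n).ι) :=
  (iff_of_eq (congrArg (fun f ↦ Cofibration f) (latchingMap_eq A n))).trans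
    (cofibration_comp_iso_iff _ _)

lemma fibration_matchingMap_iff {D : Type u} [Category.{w} D] [HasLimits D] [ModelCategory D]
    (Y : SimplexCategoryᵒᵖ ⥤ D) (n : ℕ) :
    Fibration (matchingMap Y n) ↔ Cofibration (tensorMap Y.rightOp (SSet.boundary.{w} n).ι) :=
  (iff_of_eq (congrArg (fun f ↦ Fibration f) (matchingMap_eq Y n))).trans
    ((fibration_comp_iso_iff _ _).trans
      ((fibration_unop_iff _).trans (cofibration_latchingMap_iff Y.rightOp n)))

/-- Cotensors of a terminal object are terminal, so `Y ^ L ⟶ Y ^ K` is also a pullback-corner map of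
`p`; the two corner maps are compared through the lifting properties they share by adjunction. -/
lemma reedyFibrations_from_iff {Y T : SimplexCategoryᵒᵖ ⥤ C} (hT : IsTerminal T) (p : Y ⟶ T) :
    reedyFibrations C p ↔ ∀ n : ℕ, Fibration (matchingMap Y n) := by
  refine forall_congr' (fun n ↦ ?_)
  have h (L : SSet.{w}) : IsTerminal ((cotensor.obj (op L)).obj T) := by
    have := ((copowerAdj C).adj L).rightAdjoint_preservesLimits
    exact hT.isTerminalObj (cotensor.obj (op L))
  let i := (SSet.boundary.{w} n).ι
  have := isIso_of_isTerminal (h Δ[n]) (h (SSet.boundary.{w} n : SSet.{w}))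
    ((cotensor.map i.op).app T)
  let sq : cotensor.PullbackObjObj i p :=
    { pt := (cotensor.obj (op (SSet.boundary.{w} n : SSet.{w}))).obj Y
      fst := 𝟙 _
      snd := (h _).from _
      isPullback := IsPullback.of_horiz_isIso ⟨(h _).hom_ext _ _⟩
      π := (cotensor.map i.op).app Y
      π_fst := Category.comp_id _
      π_snd := (h _).hom_ext _ _ }
  rw [fibration_matchingMap_iff, ← fibration_unop_iff, fibration_iff, fibration_iff,
    ← trivialCofibrations_rlp]
  refine forall_congr' fun a ↦ forall_congr' fun b ↦ forall_congr' fun j ↦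
    forall_congr' fun _ ↦ ?_
  rw [← hasLiftingProperty_copowerCorner_iff]
  exact (copowerAdj C).hasLiftingProperty_iff _ sq

end ReedyFibrations

/-! ### Existence of cosimplicial resolutions -/

section CosimplicialResolutions

variable {C : Type u} [Category.{w} C]

lemma matchingMap_op [HasColimits C] (Q : SimplexCategory ⥤ C) (n : ℕ) :
    matchingMap Q.op n = (latchingMap Q n).op ≫
      (limitOpIsoOpColimit (CostructuredArrow.proj simplexFunctor.{w}
        (∂Δ[n] : SSet.{w}) ⋙ Q)).inv := by
  apply limit.hom_ext
  intro σ
  refine (limit.lift_π _ _).trans (Eq.trans ?_ (Category.assoc _ _ _).symm)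
  refine Eq.trans ?_ (congrArg ((latchingMap Q n).op ≫ ·)
    (limitOpIsoOpColimit_inv_comp_π _ σ)).symm
  have h := colimit.ι_desc (F := CostructuredArrow.proj simplexFunctor.{w}
    (∂Δ[n] : SSet.{w}) ⋙ Q)
    (Cocone.mk (Q.obj ⦋n⦌)
      { app σ := Q.map (boundaryHom σ)
        naturality σ τ g := ((Q.map_comp _ _).symm.trans
          (congrArg Q.map (comp_boundaryHom g))).trans (Category.comp_id _).symm }) σ.unop
  exact (congrArg Quiver.Hom.op h).symm

lemma trivialCofibration_copowerCorner_app [HasColimits C] [ModelCategory C] {K L : SSet.{w}}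
    (i : K ⟶ L) [Mono i] {a b : C} (j : a ⟶ b) [Cofibration j] [WeakEquivalence j]
    (m : SimplexCategoryᵒᵖ) :
    Cofibration ((copowerCorner i j).app m) ∧ WeakEquivalence ((copowerCorner i j).app m) := by
  rw [← mem_trivialCofibrations_iff, ← fibrations_llp]
  intro E B f hf
  rw [← fibration_iff] at hf
  exact hasLiftingProperty_copowerCorner_app _ _ _ _

variable [HasLimits C] [HasColimits C] [ModelCategory C]

/-- A cosimplicial object with the left lifting property with respect to the levelwise trivial
fibrations is Reedy cofibrant. -/
lemma cofibration_latchingMap_of_lift {Q : SimplexCategory ⥤ C}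
    (hQ : ∀ {E B : SimplexCategory ⥤ C} (p : E ⟶ B)
      (_ : ∀ m, Fibration (p.app m) ∧ WeakEquivalence (p.app m)) (v : Q ⟶ B),
      ∃ l : Q ⟶ E, l ≫ p = v) (n : ℕ) : Cofibration (latchingMap Q n) := by
  -- The cells testing Reedy fibrancy of `Q.op` are levelwise trivial cofibrations of `Cᵒᵖ`, that
  -- is, levelwise trivial fibrations of `C`, against which `Q` lifts by assumption.
  have h : reedyFibrations Cᵒᵖ (terminal.from Q.op) := by
    rw [reedyFibrations_eq]
    rintro X Y _ ⟨j, n⟩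
    constructor
    intro f g sq
    obtain ⟨_, _⟩ := (mem_trivialCofibrations_iff _).1 j.2
    let e := copowerCorner (SSet.boundary.{w} n).ι j.1.hom
    obtain ⟨l, hl⟩ := hQ (NatTrans.unop e) (fun m ↦ by
      obtain ⟨_, _⟩ := trivialCofibration_copowerCorner_app (SSet.boundary.{w} n).ι j.1.hom (op m)
      exact ⟨inferInstanceAs (Fibration (e.app (op m)).unop),
        inferInstanceAs (WeakEquivalence (e.app (op m)).unop)⟩) (NatTrans.unop f)
    exact ⟨⟨⟨NatTrans.op l, congrArg NatTrans.op hl, terminalIsTerminal.hom_ext _ _⟩⟩⟩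
  rw [reedyFibrations_from_iff terminalIsTerminal] at h
  have h' := h n
  rw [matchingMap_op] at h'
  have := (fibration_comp_iso_iff _ (limitOpIsoOpColimit _).symm).1 h'
  exact (fibration_op_iff (latchingMap Q n)).1 this

/-- A projective-type cofibrant replacement of the constant object: the generators are the free
cosimplicial objects on `I`, whose right lifting class is the levelwise trivial fibrations. -/
lemma nonempty_cosimplicialResolution [IsLocallyPresentable.{w} C] {I : MorphismProperty C}
    [MorphismProperty.IsSmall.{w} I] (hI : I.rlp = trivialFibrations C) (A : C) :
    Nonempty (CosimplicialResolution (inferInstanceAs (ModelCategory C)) A) := by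
  have := isLocallyPresentable_cosimplicialObject C
  let W : MorphismProperty (SimplexCategory ⥤ C) :=
    MorphismProperty.ofHoms (fun x : I.toSet × SimplexCategory ↦
      (evaluationLeftAdjoint C x.2).map x.1.1.hom)
  have hW {E B : SimplexCategory ⥤ C} (p : E ⟶ B) :
      W.rlp p ↔ ∀ m, trivialFibrations C (p.app m) := by
    rw [← hI]
    constructor
    · intro hp m a b i hi
      exact ((evaluationAdjunctionRight C m).hasLiftingProperty_iff i p).1
        (hp _ ⟨((⟨Arrow.mk i, hi⟩ : I.toSet), m)⟩)
    · rintro hp _ _ _ ⟨i, m⟩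
      exact ((evaluationAdjunctionRight C m).hasLiftingProperty_iff i.1.hom p).2 (hp m _ i.2)
  have : MorphismProperty.IsSmall.{w} W := by
    dsimp only [W]
    infer_instance
  have := hasSmallObjectArgument_of_isLocallyPresentable W
  let d := MorphismProperty.factorizationData W.rlp.llp W.rlp
    (initial.to ((Functor.const SimplexCategory).obj A))
  refine ⟨{ obj := d.Z, π := d.p, weakEquivalence := fun m ↦ ?_, reedyCofibrant := ?_ }⟩
  · have := (hW _).1 d.hp m
    rw [mem_trivialFibrations_iff] at this
    exact this.2
  · apply cofibration_latchingMap_of_lift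
    intro E B p hp v
    have : HasLiftingProperty d.i p := d.hi p ((hW p).2 (fun m ↦ by
      rw [mem_trivialFibrations_iff]
      exact hp m))
    have sq : CommSq (initial.to E) d.i p v := ⟨initialIsInitial.hom_ext _ _⟩
    exact ⟨sq.lift, sq.fac_right⟩

end CosimplicialResolutions

/-! ### Singular complexes of Reedy cofibrant homotopically constant cosimplicial objects -/

section SingularComplexes

open SSet.modelCategoryQuillen

lemma fibration_of_hasLiftingProperty_facets {E B : SSet.{w}} {q : E ⟶ B}
    (hq : ∀ (n : ℕ) (S : Set (Fin (n + 1))), S.Nonempty → S ≠ Set.univ →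
      HasLiftingProperty (facets.{w} n S).ι q) : Fibration q := by
  rw [SSet.modelCategoryQuillen.fibration_iff]
  intro X Y i hi
  simp only [J, MorphismProperty.iSup_iff] at hi
  obtain ⟨n, ⟨i⟩⟩ := hi
  rw [← facets_compl_singleton]
  refine hq _ _ ?_ ?_
  · obtain ⟨j, hj⟩ := exists_ne i
    exact ⟨j, hj⟩
  · intro h
    have : i ∈ ({i}ᶜ : Set _) := h ▸ Set.mem_univ i
    exact this rfl

lemma rlp_I_iff {E B : SSet.{w}} (q : E ⟶ B) :
    I.rlp q ↔ ∀ n : ℕ, HasLiftingProperty (SSet.boundary.{w} n).ι q := by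
  constructor
  · intro hq n
    exact hq _ (boundary_ι_mem_I n)
  · rintro hq _ _ _ ⟨n⟩
    exact hq n

lemma rlp_singular_map_iff {D : Type u} [Category.{w} D] [HasColimits D] (A : SimplexCategory ⥤ D)
    {X Y : D} (f : X ⟶ Y) :
    I.rlp ((singular A).map f) ↔
      ∀ n : ℕ, HasLiftingProperty (tensorMap A (SSet.boundary.{w} n).ι) f := by
  rw [rlp_I_iff]
  exact forall_congr' fun n ↦
    ((tensorAdj A).hasLiftingProperty_iff (SSet.boundary.{w} n).ι f).symm

variable {D : Type u} [Category.{w} D] [HasColimits D] [ModelCategory D]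
  {A : SimplexCategory ⥤ D}

lemma weakEquivalence_tensorMap_iff {m n : SimplexCategory} (f : m ⟶ n) :
    WeakEquivalence (tensorMap A (SSet.stdSimplex.{w}.map f)) ↔ WeakEquivalence (A.map f) := by
  have h := tensorStdSimplexIso_inv_tensorMap.{w} A f
  constructor
  · intro
    have : WeakEquivalence (A.map f ≫ (tensorStdSimplexIso A n).inv) := by
      rw [← h]
      infer_instance
    exact weakEquivalence_of_postcomp (A.map f) (tensorStdSimplexIso A n).inv
  · intro
    have : WeakEquivalence ((tensorStdSimplexIso A m).inv ≫
        tensorMap A (SSet.stdSimplex.{w}.map f)) := by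
      rw [h]
      infer_instance
    exact weakEquivalence_of_precomp (tensorStdSimplexIso A m).inv _

lemma isReedyCofibrantConstant_tensorFunctor (hA : ∀ n : ℕ, Cofibration (latchingMap A n))
    (hA' : ∀ {m n : SimplexCategory} (f : m ⟶ n), WeakEquivalence (A.map f)) :
    IsReedyCofibrantConstant (tensorFunctor A) where
  isLeftAdjoint := inferInstance
  cofibration n := (cofibration_latchingMap_iff A n).1 (hA n)
  weakEquivalence f := (weakEquivalence_tensorMap_iff f).2 (hA' f)

variable (hA : IsReedyCofibrantConstant (tensorFunctor A)) {X Y : D} (f : X ⟶ Y)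

include hA

lemma fibration_singular_map [Fibration f] : Fibration ((singular A).map f) := by
  apply fibration_of_hasLiftingProperty_facets
  intro n S hS hS'
  rw [← (tensorAdj A).hasLiftingProperty_iff]
  have := cofibration_map_facets (tensorFunctor A) hA.cofibration n S
  have := hA.weakEquivalence_facets n S hS hS'
  infer_instance

lemma kanComplex_singular_obj (hX : IsFibrant X) : SSet.KanComplex ((singular A).obj X) := by
  have := (tensorAdj A).rightAdjoint_preservesLimits
  have h : IsTerminal ((singular A).obj (⊤_ D)) := terminalIsTerminal.isTerminalObj (singular A)
  have := fibration_singular_map hA (terminal.from X)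
  exact (isFibrant_iff_of_isTerminal ((singular A).map (terminal.from X)) h).2 this

lemma rlp_singular_map [Fibration f] [WeakEquivalence f] : I.rlp ((singular A).map f) := by
  rw [rlp_singular_map_iff A]
  intro n
  have := hA.cofibration n
  exact inferInstanceAs (HasLiftingProperty ((tensorFunctor A).map (SSet.boundary.{w} n).ι) f)

/-- Ken Brown's argument: `f` is a section of a trivial fibration followed by a trivial fibration,
and trivial fibrations go to trivial Kan fibrations. -/
lemma isWeakHomotopyEquivalence_singular_map [IsFibrant X] [IsFibrant Y] [WeakEquivalence f] :
    IsWeakHomotopyEquivalence ((singular A).map f) := by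
  let h : FibrantBrownFactorization f := Classical.arbitrary _
  have h₁ : weakHomotopyEquivalences ((singular A).map h.r) :=
    isWeakHomotopyEquivalence_of_rlp (rlp_singular_map hA h.r)
  have h₂ := isWeakHomotopyEquivalence_of_rlp (rlp_singular_map hA h.p)
  have h₃ : IsWeakHomotopyEquivalence ((singular A).map h.i) := by
    refine MorphismProperty.of_postcomp weakHomotopyEquivalences ((singular A).map h.i)
      ((singular A).map h.r) h₁ ?_
    rw [← (singular A).map_comp, h.i_r, (singular A).map_id]
    exact weakHomotopyEquivalences.id_mem _
  rw [← h.fac, (singular A).map_comp]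
  exact weakHomotopyEquivalences.comp_mem _ _ h₃ h₂

/-- Turns the homotopical condition on a fibration into a lifting property, hence into one tested by
`A ⊗ ∂Δ[n] ⟶ A ⊗ Δ[n]`. -/
lemma isWeakHomotopyEquivalence_singular_map_iff [IsFibrant X] [IsFibrant Y] [Fibration f] :
    IsWeakHomotopyEquivalence ((singular A).map f) ↔ I.rlp ((singular A).map f) := by
  have := fibration_singular_map hA f
  exact ⟨rlp_of_isWeakHomotopyEquivalence _ (kanComplex_singular_obj hA inferInstance)
    (kanComplex_singular_obj hA inferInstance), isWeakHomotopyEquivalence_of_rlp⟩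

end SingularComplexes

/-! ### Homotopy function complexes -/

section FunctionComplexes

open SSet.modelCategoryQuillen

variable {C : Type u} [Category.{w} C]

lemma hasLiftingProperty_iff_of_isInitial {X₀ X E B : C} (hX : IsInitial X₀) (i : X₀ ⟶ X)
    (q : E ⟶ B) : HasLiftingProperty i q ↔ ∀ b : X ⟶ B, ∃ e : X ⟶ E, e ≫ q = b := by
  constructor
  · intro _ b
    have sq : CommSq (hX.to E) i q b := ⟨hX.hom_ext _ _⟩
    exact ⟨sq.lift, sq.fac_right⟩
  · intro h
    constructor
    intro f g sq
    obtain ⟨e, he⟩ := h g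
    exact ⟨⟨⟨e, hX.hom_ext _ _, he⟩⟩⟩

section

variable [ModelCategory C]

/-- Lifts extend from `X` to `W` because `q` is a fibration; conversely a map on `X` first extends
to `W` because `B` is fibrant. -/
lemma exists_lift_iff_of_trivialCofibration {X W E B : C} (j : X ⟶ W) [Cofibration j]
    [WeakEquivalence j] (q : E ⟶ B) [Fibration q] [IsFibrant B] :
    (∀ b : X ⟶ B, ∃ e : X ⟶ E, e ≫ q = b) ↔ ∀ b : W ⟶ B, ∃ e : W ⟶ E, e ≫ q = b := by
  constructor
  · intro h b
    obtain ⟨e, he⟩ := h (j ≫ b)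
    have sq : CommSq e j q b := ⟨he⟩
    exact ⟨sq.lift, sq.fac_right⟩
  · intro h b
    have sq : CommSq b j (terminal.from B) (terminal.from W) := ⟨Subsingleton.elim _ _⟩
    obtain ⟨e, he⟩ := h sq.lift
    exact ⟨j ≫ e, by rw [Category.assoc, he, sq.fac_left]⟩

/-- Cofibrant objects which are weakly equivalent over some object lift against the same
fibrations. -/
lemma exists_lift_iff_of_weakEquivalence {X X' X₀ E B : C} [IsCofibrant X] [IsCofibrant X']
    (f : X ⟶ X₀) (f' : X' ⟶ X₀) [WeakEquivalence f] [WeakEquivalence f'] (q : E ⟶ B)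
    [Fibration q] [IsFibrant B] :
    (∀ b : X ⟶ B, ∃ e : X ⟶ E, e ≫ q = b) ↔ ∀ b : X' ⟶ B, ∃ e : X' ⟶ E, e ≫ q = b := by
  -- Both summands include into the middle object by trivial cofibrations: cofibrancy makes the
  -- summand inclusions cofibrations, and two out of three does the rest.
  let d := MorphismProperty.factorizationData (cofibrations C) (trivialFibrations C)
    (coprod.desc f f')
  have h₁ : (coprod.inl ≫ d.i) ≫ d.p = f := by rw [Category.assoc, d.fac, coprod.inl_desc]
  have h₂ : (coprod.inr ≫ d.i) ≫ d.p = f' := by rw [Category.assoc, d.fac, coprod.inr_desc]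
  have := weakEquivalence_of_postcomp_of_fac h₁
  have := weakEquivalence_of_postcomp_of_fac h₂
  rw [exists_lift_iff_of_trivialCofibration (coprod.inl ≫ d.i) q,
    exists_lift_iff_of_trivialCofibration (coprod.inr ≫ d.i) q]

end

variable [HasLimits C]

/-- A Reedy fibrant simplicial object whose structure maps are weak equivalences. -/
structure IsReedyFibrantConstant [ModelCategory C] (Y : SimplexCategoryᵒᵖ ⥤ C) : Prop where
  fibration (n : ℕ) : Fibration (matchingMap Y n)
  weakEquivalence {m n : SimplexCategoryᵒᵖ} (f : m ⟶ n) : WeakEquivalence (Y.map f)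

lemma IsReedyFibrantConstant.tensorFunctor [ModelCategory C] {Y : SimplexCategoryᵒᵖ ⥤ C}
    (hY : IsReedyFibrantConstant Y) : IsReedyCofibrantConstant (tensorFunctor Y.rightOp) :=
  isReedyCofibrantConstant_tensorFunctor
    (fun n ↦ (cofibration_latchingMap_iff _ _).2 ((fibration_matchingMap_iff Y n).1
      (hY.fibration n)))
    (fun f ↦ by
      have := hY.weakEquivalence f.op
      exact inferInstanceAs (WeakEquivalence (Y.map f.op).op))

section

variable {Y Z : SimplexCategoryᵒᵖ ⥤ C} (p : Y ⟶ Z)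

lemma tensorStdSimplexIso_inv_tensorTransApp (m : SimplexCategory) :
    (tensorStdSimplexIso.{w} Z.rightOp m).inv ≫
      tensorTransApp (NatTrans.rightOp p) (SSet.stdSimplex.obj m) =
    (p.app (op m)).op ≫ (tensorStdSimplexIso.{w} Y.rightOp m).inv :=
  tensorι_tensorTransApp (NatTrans.rightOp p) _

/-- The relative matching map in degree zero. -/
def relativeMatchingMapZeroIso :
    Arrow.mk (relativeMatchingMap p (SSet.boundary.{w} 0).ι) ≅ Arrow.mk (p.app (op ⦋0⦌)) := by
  let τ := tensorTrans (NatTrans.rightOp p)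
  have h : IsInitial (∂Δ[0] : SSet.{w}) := by
    rw [SSet.boundary_zero]
    exact SSet.Subcomplex.isInitialBot
  have : IsIso (τ.app (∂Δ[0] : SSet.{w})) :=
    isIso_of_isInitial (h.isInitialObj (tensorFunctor Z.rightOp))
      (h.isInitialObj (tensorFunctor Y.rightOp)) _
  refine Arrow.isoMk (tensorStdSimplexIso Y.rightOp ⦋0⦌).symm.unop
    (asIso (pushout.inl ((tensorFunctor Z.rightOp).map (SSet.boundary.{w} 0).ι)
      (τ.app (∂Δ[0] : SSet.{w}))).unop ≪≫ (tensorStdSimplexIso Z.rightOp ⦋0⦌).symm.unop) ?_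
  refine congrArg Quiver.Hom.unop ((tensorStdSimplexIso_inv_tensorTransApp p ⦋0⦌).symm.trans ?_)
  refine Eq.trans ?_ (Category.assoc _ _ _).symm
  exact congrArg ((tensorStdSimplexIso.{w} Z.rightOp ⦋0⦌).inv ≫ ·)
    (inl_relativeLatchingMap τ (SSet.boundary.{w} 0).ι).symm

lemma rlp_homComplexMap_iff [HasColimits C] (X : C) :
    I.rlp (homComplexMap X p) ↔ ∀ n : ℕ, ∀ b, ∃ e : X ⟶ _,
      e ≫ relativeMatchingMap p (SSet.boundary.{w} n).ι = b := by
  rw [rlp_I_iff]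
  refine forall_congr' fun n ↦ ?_
  rw [hasLiftingProperty_homComplexMap_iff, hasLiftingProperty_iff_of_isInitial initialIsInitial]

end

section

variable [ModelCategory C] {Y Z : SimplexCategoryᵒᵖ ⥤ C} {p : Y ⟶ Z}

lemma fibration_app_zero (hp : reedyFibrations C p) : Fibration (p.app (op ⦋0⦌)) := by
  have := hp 0
  rw [HomotopicalAlgebra.fibration_iff] at this ⊢
  exact ((fibrations C).arrow_mk_iso_iff (relativeMatchingMapZeroIso p)).1 this

lemma cofibration_relativeLatchingMap_of_reedyFibrations (hp : reedyFibrations C p) (n : ℕ) :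
    Cofibration (relativeLatchingMap (tensorTrans (NatTrans.rightOp p))
      (SSet.boundary.{w} n).ι) :=
  (fibration_unop_iff _).1 (hp n)

variable [HasColimits C] (hp : reedyFibrations C p) (hY : IsReedyFibrantConstant Y)
  (hZ : IsReedyFibrantConstant Z) (X : C) [IsCofibrant X]

include hp hY hZ

/-- By constancy the relative matching maps at horns are trivial fibrations, so the cofibrant `X`
lifts against them. -/
lemma fibration_homComplexMap : Fibration (homComplexMap X p) := by
  apply fibration_of_hasLiftingProperty_facets
  intro n S hS hS'
  rw [hasLiftingProperty_homComplexMap_iff]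
  have := cofibration_relativeLatchingMap_facets _
    (cofibration_relativeLatchingMap_of_reedyFibrations hp) n S
  have := cofibration_map_facets _ hZ.tensorFunctor.cofibration n S
  have := hZ.tensorFunctor.weakEquivalence_facets n S hS hS'
  have := hY.tensorFunctor.weakEquivalence_facets n S hS hS'
  have := weakEquivalence_relativeLatchingMap (tensorTrans (NatTrans.rightOp p)) (facets.{w} n S).ι
  dsimp only [relativeMatchingMap]
  infer_instance

lemma rlp_homComplexMap (hp' : ∀ m, WeakEquivalence (p.app m)) :
    I.rlp (homComplexMap X p) := by
  rw [rlp_I_iff]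
  intro n
  rw [hasLiftingProperty_homComplexMap_iff]
  have := cofibration_relativeLatchingMap_of_reedyFibrations hp n
  have := weakEquivalence_relativeLatchingMap_boundary _ hZ.tensorFunctor hY.tensorFunctor
    (cofibration_relativeLatchingMap_of_reedyFibrations hp) (fun n ↦ by
      have h := tensorStdSimplexIso_inv_tensorTransApp p ⦋n⦌
      have := hp' (op ⦋n⦌)
      have : WeakEquivalence ((tensorStdSimplexIso.{w} Z.rightOp ⦋n⦌).inv ≫
          tensorTransApp (NatTrans.rightOp p) Δ[n]) := by
        rw [h]
        infer_instance
      exact weakEquivalence_of_precomp (tensorStdSimplexIso.{w} Z.rightOp ⦋n⦌).inv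
        (tensorTransApp (NatTrans.rightOp p) Δ[n])) n
  dsimp only [relativeMatchingMap]
  infer_instance

end

section

variable [HasColimits C] [ModelCategory C]

lemma kanComplex_homComplex {Y : SimplexCategoryᵒᵖ ⥤ C} (hY : IsReedyFibrantConstant Y) (X : C)
    [IsCofibrant X] : SSet.KanComplex (homComplex X Y) := by
  let T : SimplexCategoryᵒᵖ ⥤ C := (Functor.const _).obj (⊤_ C)
  have hT : IsTerminal T :=
    IsTerminal.ofUniqueHom (fun _ ↦ { app _ := terminal.from _ }) (fun _ _ ↦ by
      ext
      exact Subsingleton.elim (α := _ ⟶ ⊤_ C) _ _)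
  have h₁ : IsReedyFibrantConstant T :=
    { fibration := (reedyFibrations_from_iff hT (𝟙 T)).1 (by
        rw [reedyFibrations_eq]
        exact MorphismProperty.id_mem _ _)
      weakEquivalence f := inferInstanceAs (WeakEquivalence (𝟙 (⊤_ C))) }
  let p : Y ⟶ T := hT.from Y
  have hp : reedyFibrations C p := (reedyFibrations_from_iff hT p).2 hY.fibration
  have : PreservesLimitsOfSize.{0, 0} ((Functor.whiskeringRight SimplexCategoryᵒᵖ C _).obj
      (coyoneda.obj (op X))) :=
    ((sigmaConstAdj X).whiskerRight SimplexCategoryᵒᵖ).rightAdjoint_preservesLimits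
  have h₂ : IsTerminal (homComplex X T) :=
    hT.isTerminalObj ((Functor.whiskeringRight _ _ _).obj (coyoneda.obj (op X)))
  exact (isFibrant_iff_of_isTerminal (homComplexMap X p) h₂).2
    (fibration_homComplexMap hp hY h₁ X)

/-- Both sides say that a Kan fibration between Kan complexes is trivial. In degree `n` the left one
says that `X` lifts against the `n`-th relative matching map; here `X` may be replaced by `A ⊗
Δ[0]`, and the exchange of degrees gives `A ⊗ ∂Δ[n] ⟶ A ⊗ Δ[n]` lifting against `p_0`. -/
lemma isWeakHomotopyEquivalence_homComplexMap_iff (hC : ∀ X : C, IsFibrant X)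
    {Y Z : SimplexCategoryᵒᵖ ⥤ C} {p : Y ⟶ Z} (hp : reedyFibrations C p)
    (hY : IsReedyFibrantConstant Y) (hZ : IsReedyFibrantConstant Z)
    {X X₀ : C} [IsCofibrant X] (f : X ⟶ X₀) [WeakEquivalence f]
    {A : SimplexCategory ⥤ C} (hA : IsReedyCofibrantConstant (tensorFunctor A))
    (g : A.obj ⦋0⦌ ⟶ X₀) [WeakEquivalence g] :
    IsWeakHomotopyEquivalence (homComplexMap X p) ↔
      IsWeakHomotopyEquivalence ((singular A).map (p.app (op ⦋0⦌))) := by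
  have := fibration_homComplexMap hp hY hZ X
  have := fibration_app_zero hp
  have h₁ : IsWeakHomotopyEquivalence (homComplexMap X p) ↔ I.rlp (homComplexMap X p) :=
    ⟨rlp_of_isWeakHomotopyEquivalence _ (kanComplex_homComplex hY X)
      (kanComplex_homComplex hZ X), isWeakHomotopyEquivalence_of_rlp⟩
  have := hC (Y.obj (op ⦋0⦌))
  have := hC (Z.obj (op ⦋0⦌))
  rw [h₁, isWeakHomotopyEquivalence_singular_map_iff hA, rlp_homComplexMap_iff,
    rlp_singular_map_iff]
  refine forall_congr' fun n ↦ ?_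
  have := hp n
  have := hC (pushout ((tensorFunctor Z.rightOp).map (SSet.boundary.{w} n).ι)
    ((tensorTrans (NatTrans.rightOp p)).app _)).unop
  have : IsCofibrant (tensorObj A Δ[0]) := hA.isCofibrant 0
  have h₀ : IsInitial (∂Δ[0] : SSet.{w}) := by
    rw [SSet.boundary_zero]
    exact SSet.Subcomplex.isInitialBot
  refine (exists_lift_iff_of_weakEquivalence f ((tensorStdSimplexIso A ⦋0⦌).hom ≫ g) _).trans ?_
  refine (hasLiftingProperty_iff_of_isInitial (h₀.isInitialObj (tensorFunctor A))
    (tensorMap A (SSet.boundary.{w} 0).ι) _).symm.trans ?_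
  refine (hasLiftingProperty_latching_iff (tensorTrans (NatTrans.rightOp p)) hA
    hZ.tensorFunctor hY.tensorFunctor
    (cofibration_relativeLatchingMap_of_reedyFibrations hp) hC n).symm.trans ?_
  exact HasLiftingProperty.iff_of_arrow_iso_right _ (relativeMatchingMapZeroIso p)

end

end FunctionComplexes

/-! ### Characterization of the colocal equivalences -/

section ColocalEquivalences

lemma homComplexMap_comp {C : Type u} [Category.{w} C] (X : C)
    {Y Y' Y'' : SimplexCategoryᵒᵖ ⥤ C} (f : Y ⟶ Y') (g : Y' ⟶ Y'') :
    homComplexMap X (f ≫ g) = homComplexMap X f ≫ homComplexMap X g :=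
  Functor.whiskerRight_comp _ _ _

lemma homComplexMap_id {C : Type u} [Category.{w} C] (X : C) (Y : SimplexCategoryᵒᵖ ⥤ C) :
    homComplexMap X (𝟙 Y) = 𝟙 (homComplex X Y) :=
  Functor.whiskerRight_id' _

variable {C : Type u} [Category.{w} C] [HasLimits C]

section

variable [M : ModelCategory C]

lemma SimplicialResolution.isReedyFibrantConstant {Y : C} (r : SimplicialResolution M Y) :
    IsReedyFibrantConstant r.obj where
  fibration := r.reedyFibrant
  weakEquivalence {m n} f := by
    have := r.weakEquivalence
    have h := r.ι.naturality f
    have : WeakEquivalence (r.ι.app m ≫ r.obj.map f) := by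
      rw [← h]
      exact inferInstanceAs (WeakEquivalence (𝟙 Y ≫ r.ι.app n))
    exact weakEquivalence_of_precomp (r.ι.app m) _

lemma CosimplicialResolution.isReedyCofibrantConstant {C : Type u} [Category.{w} C]
    [HasColimits C] [M : ModelCategory C] {A : C} (r : CosimplicialResolution M A) :
    IsReedyCofibrantConstant (tensorFunctor r.obj) :=
  isReedyCofibrantConstant_tensorFunctor r.reedyCofibrant (fun {m n} f ↦ by
    have := r.weakEquivalence
    have h := r.π.naturality f
    have : WeakEquivalence (r.obj.map f ≫ r.π.app n) := by
      rw [h]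
      have : WeakEquivalence (((Functor.const SimplexCategory).obj A).map f) :=
        inferInstanceAs (WeakEquivalence (𝟙 A))
      infer_instance
    exact weakEquivalence_of_postcomp _ (r.π.app n))

end

variable [HasColimits C] [IsLocallyPresentable.{w} C] [M : ModelCategory C]
  {J : MorphismProperty C} [MorphismProperty.IsSmall.{w} J] (hJ : J.rlp = fibrations C)

include hJ

lemma nonempty_simplicialResolutionHom {X Y : C} (f : X ⟶ Y) :
    Nonempty (SimplicialResolutionHom M f) := by
  obtain ⟨U, c, p, -, hc, hp⟩ := exists_reedy_factorization hJ
    (terminal.from ((Functor.const SimplexCategoryᵒᵖ).obj X))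
  obtain ⟨V, d, q, -, hd, hq⟩ := exists_reedy_factorization hJ
    (terminal.from ((Functor.const SimplexCategoryᵒᵖ).obj Y))
  have := hc q hq
  have sq : CommSq ((Functor.const SimplexCategoryᵒᵖ).map f ≫ d) c q (terminal.from _) :=
    ⟨Subsingleton.elim _ _⟩
  exact ⟨{
    source :=
      { obj := U
        ι := c
        weakEquivalence m := (weakEquivalence_app_of_llp hc m).2
        reedyFibrant := (reedyFibrations_from_iff terminalIsTerminal _).1 hp }
    target :=
      { obj := V
        ι := d
        weakEquivalence m := (weakEquivalence_app_of_llp hd m).2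
        reedyFibrant := (reedyFibrations_from_iff terminalIsTerminal _).1 hq }
    hom := sq.lift
    comm := sq.fac_left }⟩

variable (hC : ∀ X : C, IsFibrant X)

include hC

/-- Reduction to Reedy fibrations: factoring the graph of `r` writes `r` as `c` followed by the
Reedy fibration `q ≫ prod.snd`, where `c` is a section of the levelwise trivial Reedy fibration `q ≫
prod.fst` and so is inverted on both sides. -/
lemma isWeakHomotopyEquivalence_homComplexMap_iff_singular_map {U V : SimplexCategoryᵒᵖ ⥤ C}
    (hU : IsReedyFibrantConstant U) (hV : IsReedyFibrantConstant V) (r : U ⟶ V)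
    {X X₀ : C} [IsCofibrant X] (f : X ⟶ X₀) [WeakEquivalence f]
    {A : SimplexCategory ⥤ C} (hA : IsReedyCofibrantConstant (tensorFunctor A))
    (g : A.obj ⦋0⦌ ⟶ X₀) [WeakEquivalence g] :
    IsWeakHomotopyEquivalence (homComplexMap X r) ↔
      IsWeakHomotopyEquivalence ((singular A).map (r.app (op ⦋0⦌))) := by
  obtain ⟨W, c, q, fac, hc, hq⟩ := exists_reedy_factorization hJ (prod.lift (𝟙 U) r)
  have rU : reedyFibrations C (terminal.from U) :=
    (reedyFibrations_from_iff terminalIsTerminal _).2 hU.fibration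
  have rV : reedyFibrations C (terminal.from V) :=
    (reedyFibrations_from_iff terminalIsTerminal _).2 hV.fibration
  have sq : IsPullback (prod.fst : U ⨯ V ⟶ U) prod.snd (terminal.from U) (terminal.from V) :=
    IsPullback.of_is_product (prodIsProd U V) terminalIsTerminal
  have h₁ : reedyFibrations C (q ≫ prod.fst) :=
    (reedyFibrations C).comp_mem _ _ hq ((reedyFibrations C).of_isPullback sq.flip rV)
  have h₂ : reedyFibrations C (q ≫ prod.snd) :=
    (reedyFibrations C).comp_mem _ _ hq ((reedyFibrations C).of_isPullback sq rU)
  have e₁ : c ≫ q ≫ prod.fst = 𝟙 U := by rw [← Category.assoc, fac, prod.lift_fst]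
  have e₂ : c ≫ q ≫ prod.snd = r := by rw [← Category.assoc, fac, prod.lift_snd]
  have hc' m := (weakEquivalence_app_of_llp hc m).2
  have hW : IsReedyFibrantConstant W :=
    { fibration := (reedyFibrations_from_iff terminalIsTerminal
        ((q ≫ prod.fst) ≫ terminal.from U)).1 ((reedyFibrations C).comp_mem _ _ h₁ rU)
      weakEquivalence {m n} f := by
        have := hU.weakEquivalence f
        have : WeakEquivalence (c.app m ≫ W.map f) := by
          rw [← c.naturality]
          infer_instance
        exact weakEquivalence_of_precomp (c.app m) _ }
  have w₁ (m) : WeakEquivalence ((q ≫ prod.fst).app m) := by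
    have h := NatTrans.congr_app e₁ m
    rw [NatTrans.comp_app, NatTrans.id_app] at h
    exact weakEquivalence_of_precomp_of_fac h
  have k₀ : weakHomotopyEquivalences (homComplexMap X (q ≫ prod.fst)) :=
    isWeakHomotopyEquivalence_of_rlp (rlp_homComplexMap h₁ hW hU X w₁)
  have k₁ : weakHomotopyEquivalences (homComplexMap X c) := by
    refine MorphismProperty.of_postcomp weakHomotopyEquivalences _ _ k₀ ?_
    rw [← homComplexMap_comp, e₁, homComplexMap_id]
    exact weakHomotopyEquivalences.id_mem _
  have := hC (U.obj (op ⦋0⦌))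
  have := hC (W.obj (op ⦋0⦌))
  have k₂ : weakHomotopyEquivalences ((singular A).map (c.app (op ⦋0⦌))) :=
    isWeakHomotopyEquivalence_singular_map hA _
  rw [← e₂, homComplexMap_comp, NatTrans.comp_app, (singular A).map_comp]
  refine (weakHomotopyEquivalences.precomp_iff _ _ k₁).trans (Iff.trans ?_
    (weakHomotopyEquivalences.precomp_iff _ _ k₂).symm)
  exact isWeakHomotopyEquivalence_homComplexMap_iff hC h₂ hW hV f hA g

/-- The coaugmentations compare `h` with `r.hom` in degree zero. The right side involves neither `X`
nor `r`, and the left side does not involve `s`, which gives independence of all choices. -/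
lemma SimplicialResolutionHom.isWeakHomotopyEquivalence_iff {Y Z : C} {h : Y ⟶ Z}
    (r : SimplicialResolutionHom M h) {A : C} (X : CofibrantApproximation M A)
    (s : CosimplicialResolution M A) :
    IsWeakHomotopyEquivalence (homComplexMap X.obj r.hom) ↔
      IsWeakHomotopyEquivalence ((singular s.obj).map h) := by
  have := X.cofibrant
  have := X.weakEquivalence
  have hs := s.isReedyCofibrantConstant
  have := s.weakEquivalence ⦋0⦌
  rw [isWeakHomotopyEquivalence_homComplexMap_iff_singular_map hJ hC
    r.source.isReedyFibrantConstant r.target.isReedyFibrantConstant r.hom X.π hs (s.π.app ⦋0⦌)]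
  have e : r.source.ι.app (op ⦋0⦌) ≫ r.hom.app (op ⦋0⦌) = h ≫ r.target.ι.app (op ⦋0⦌) :=
    NatTrans.congr_app r.comm (op ⦋0⦌)
  have := r.source.weakEquivalence (op ⦋0⦌)
  have := r.target.weakEquivalence (op ⦋0⦌)
  have h₁ : weakHomotopyEquivalences ((singular s.obj).map (r.source.ι.app (op ⦋0⦌))) := by
    have := hC (((Functor.const SimplexCategoryᵒᵖ).obj Y).obj (op ⦋0⦌))
    have := hC (r.source.obj.obj (op ⦋0⦌))
    exact isWeakHomotopyEquivalence_singular_map hs _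
  have h₂ : weakHomotopyEquivalences ((singular s.obj).map (r.target.ι.app (op ⦋0⦌))) := by
    have := hC (((Functor.const SimplexCategoryᵒᵖ).obj Z).obj (op ⦋0⦌))
    have := hC (r.target.obj.obj (op ⦋0⦌))
    exact isWeakHomotopyEquivalence_singular_map hs _
  refine (weakHomotopyEquivalences.precomp_iff _ _ h₁).symm.trans ?_
  refine Iff.trans ?_ (weakHomotopyEquivalences.postcomp_iff _ _ h₂)
  rw [← (singular s.obj).map_comp, ← (singular s.obj).map_comp, e]

/-- The colocal equivalences are detected by the singular complexes of cosimplicial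
resolutions. -/
lemma colocalEquivalences_iff (K : ObjectProperty C)
    (res : ∀ A : C, K A → CosimplicialResolution M A) {Y Z : C} (h : Y ⟶ Z) :
    colocalEquivalences M K h ↔ ∀ (A : C) (hA : K A),
      IsWeakHomotopyEquivalence ((singular (res A hA).obj).map h) := by
  refine forall_congr' fun A ↦ forall_congr' fun hA ↦ ⟨?_, fun hh ↦ ?_⟩
  · rintro ⟨X, r, hr⟩
    exact (r.isWeakHomotopyEquivalence_iff hJ hC X (res A hA)).1 hr
  · obtain ⟨r⟩ := nonempty_simplicialResolutionHom hJ h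
    have := (res A hA).weakEquivalence ⦋0⦌
    -- Degree zero of a cosimplicial resolution is a cofibrant approximation.
    let X : CofibrantApproximation M A :=
      { obj := tensorObj (res A hA).obj Δ[0]
        π := (tensorStdSimplexIso (res A hA).obj ⦋0⦌).hom ≫ (res A hA).π.app ⦋0⦌
        cofibrant := (res A hA).isReedyCofibrantConstant.isCofibrant 0
        weakEquivalence := inferInstance }
    exact ⟨X, r, (r.isWeakHomotopyEquivalence_iff hJ hC X (res A hA)).2 hh⟩

end ColocalEquivalences

/-! ### Existence of the right Bousfield localization -/

section Localization

variable {C : Type u} [Category.{w} C]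

lemma rlp_sup (W W' : MorphismProperty C) : (W ⊔ W').rlp = W.rlp ⊓ W'.rlp := by
  ext X Y p
  exact ⟨fun h ↦ ⟨fun _ _ i hi ↦ h i (Or.inl hi), fun _ _ i hi ↦ h i (Or.inr hi)⟩,
    fun h _ _ i hi ↦ hi.elim (h.1 i) (h.2 i)⟩

lemma isSmall_sup (W W' : MorphismProperty C) [MorphismProperty.IsSmall.{w} W]
    [MorphismProperty.IsSmall.{w} W'] : MorphismProperty.IsSmall.{w} (W ⊔ W') := by
  have h : W ⊔ W' = ⨆ b : Bool, cond b W W' := (sup_eq_iSup W W')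
  have (b : Bool) : MorphismProperty.IsSmall.{w} (cond b W W') := by
    cases b <;> dsimp only [cond] <;> infer_instance
  rw [h]
  infer_instance

lemma isSmall_of_hasSmallObjectArgument (W : MorphismProperty C)
    [MorphismProperty.HasSmallObjectArgument.{w} W] : MorphismProperty.IsSmall.{w} W := by
  obtain ⟨κ, _, _, h⟩ := MorphismProperty.HasSmallObjectArgument.exists_cardinal.{w} (I := W)
  exact h.isSmall

/-- The recognition theorem for cofibrantly generated model categories. -/
lemma exists_modelCategory [HasFiniteLimits C] [HasFiniteColimits C] (W I J : MorphismProperty C)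
    [W.HasTwoOutOfThreeProperty] [MorphismProperty.HasSmallObjectArgument.{w} I]
    [MorphismProperty.HasSmallObjectArgument.{w} J] (hI : I.rlp = J.rlp ⊓ W)
    (hJ : J.rlp.llp ≤ W) :
    ∃ R : ModelCategory C, R.categoryWithWeakEquivalences.weakEquivalences = W ∧
      R.categoryWithFibrations.fibrations = J.rlp := by
  let _ : CategoryWithFibrations C := ⟨J.rlp⟩
  let _ : CategoryWithCofibrations C := ⟨I.rlp.llp⟩
  let _ : CategoryWithWeakEquivalences C := ⟨W⟩
  have : (weakEquivalences C).HasTwoOutOfThreeProperty := inferInstanceAs W.HasTwoOutOfThreeProperty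
  have h₁ : trivialFibrations C = I.rlp := hI.symm
  have h₂ : trivialCofibrations C = J.rlp.llp := by
    apply le_antisymm
    · rintro X Y f ⟨hf, hf'⟩
      -- Retract argument: the second factor is in `W` by two out of three, so `f` lifts against it
      -- and is a retract of the first factor.
      let d := MorphismProperty.factorizationData J.rlp.llp J.rlp f
      have hp : W d.p := W.of_precomp d.i d.p (hJ _ d.hi) (by rwa [d.fac])
      have : I.rlp d.p := by
        rw [hI]
        exact ⟨d.hp, hp⟩
      have := hf _ this
      exact MorphismProperty.of_retract (RetractArrow.ofLeftLiftingProperty d.fac) d.hi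
    · intro X Y f hf
      exact ⟨MorphismProperty.antitone_llp (hI.le.trans inf_le_left) _ hf, hJ _ hf⟩
  have : MorphismProperty.IsWeakFactorizationSystem (cofibrations C) (trivialFibrations C) := by
    rw [h₁]
    exact
      { rlp := MorphismProperty.rlp_llp_rlp I
        llp := rfl
        hasFactorization :=
          inferInstanceAs (MorphismProperty.HasFactorization I.rlp.llp I.rlp) }
  have : MorphismProperty.IsWeakFactorizationSystem (trivialCofibrations C) (fibrations C) := by
    rw [h₂]
    exact
      { rlp := MorphismProperty.rlp_llp_rlp J
        llp := rfl
        hasFactorization :=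
          inferInstanceAs (MorphismProperty.HasFactorization J.rlp.llp J.rlp) }
  exact ⟨ModelCategory.mk' C, rfl, rfl⟩

variable [HasLimits C] [HasColimits C] [IsLocallyPresentable.{w} C] [M : ModelCategory C]
  {J : MorphismProperty C} (hJ : J.rlp = fibrations C) (hC : ∀ X : C, IsFibrant X)
  {K : ObjectProperty C} (res : ∀ A : C, K A → CosimplicialResolution M A)

lemma hasSmallObjectArgument_Lambda_sup {C : Type u} [Category.{w} C] [HasColimits C]
    [IsLocallyPresentable.{w} C] [M : ModelCategory C] {J : MorphismProperty C}
    {K : ObjectProperty C} (res : ∀ A : C, K A → CosimplicialResolution M A)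
    [MorphismProperty.IsSmall.{w} J] [ObjectProperty.Small.{w} K] :
    MorphismProperty.HasSmallObjectArgument.{w} (Lambda K res ⊔ J) := by
  have : MorphismProperty.IsSmall.{w} (Lambda K res) := by
    dsimp only [Lambda]
    infer_instance
  have := isSmall_sup (Lambda K res) J
  exact hasSmallObjectArgument_of_isLocallyPresentable _

include hJ hC

/-- Fibrancy of all objects is essential here: a fibration that is a colocal equivalence induces a
Kan fibration between Kan complexes which is a weak equivalence, hence a trivial one. -/
lemma rlp_Lambda_sup [MorphismProperty.IsSmall.{w} J] :
    (Lambda K res ⊔ J).rlp = J.rlp ⊓ colocalEquivalences M K := by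
  rw [rlp_sup, inf_comm]
  ext X Y f
  refine and_congr_right (fun hf ↦ ?_)
  rw [hJ, ← fibration_iff] at hf
  rw [colocalEquivalences_iff hJ hC K res]
  have := hC X
  have := hC Y
  constructor
  · intro h A hA
    rw [isWeakHomotopyEquivalence_singular_map_iff (res A hA).isReedyCofibrantConstant,
      rlp_singular_map_iff]
    intro n
    exact h _ ⟨((⟨A, hA⟩ : Subtype K), n)⟩
  · rintro h _ _ _ ⟨⟨⟨A, hA⟩, n⟩⟩
    have := h A hA
    rw [isWeakHomotopyEquivalence_singular_map_iff (res A hA).isReedyCofibrantConstant,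
      rlp_singular_map_iff] at this
    exact this n

include res

/-- The definition picks a new resolution for each map; the functors `singular` do not, and so
transport the property from simplicial sets. -/
lemma hasTwoOutOfThreeProperty_colocalEquivalences [MorphismProperty.IsSmall.{w} J] :
    (colocalEquivalences M K).HasTwoOutOfThreeProperty where
  comp_mem f g hf hg := by
    rw [colocalEquivalences_iff hJ hC K res] at hf hg ⊢
    intro A hA
    rw [Functor.map_comp]
    exact weakHomotopyEquivalences.comp_mem _ _ (hf A hA) (hg A hA)
  of_postcomp f g hg hfg := by
    rw [colocalEquivalences_iff hJ hC K res] at hg hfg ⊢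
    intro A hA
    have := hfg A hA
    rw [Functor.map_comp] at this
    have hg' : weakHomotopyEquivalences ((singular (res A hA).obj).map g) := hg A hA
    exact (weakHomotopyEquivalences.postcomp_iff _ _ hg').1 this
  of_precomp f g hf hfg := by
    rw [colocalEquivalences_iff hJ hC K res] at hf hfg ⊢
    intro A hA
    have := hfg A hA
    rw [Functor.map_comp] at this
    have hf' : weakHomotopyEquivalences ((singular (res A hA).obj).map f) := hf A hA
    exact (weakHomotopyEquivalences.precomp_iff _ _ hf').1 this

lemma weakEquivalences_le_colocalEquivalences [MorphismProperty.IsSmall.{w} J] :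
    weakEquivalences C ≤ colocalEquivalences M K := by
  intro X Y f hf
  rw [← weakEquivalence_iff] at hf
  rw [colocalEquivalences_iff hJ hC K res]
  intro A hA
  have := hC X
  have := hC Y
  exact isWeakHomotopyEquivalence_singular_map (res A hA).isReedyCofibrantConstant f

end Localization

end

end RightBousfield

open RightBousfield in
theorem mainTheorem6 {C : Type u} [Category.{w} C] [HasLimits C] [HasColimits C]
    (M : ModelCategory C) (hM : RightBousfield.IsCombinatorial M)
    (hfib : RightBousfield.AllObjectsFibrant M)
    (K : ObjectProperty C) (hK : ObjectProperty.Small.{w} K) :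
    ∃ R : ModelCategory C,
      RightBousfield.IsRightBousfieldLocalization M K R ∧
      RightBousfield.IsCombinatorial R ∧
      RightBousfield.AllObjectsFibrant R ∧
      (∀ A : C, K A → Nonempty (RightBousfield.CosimplicialResolution M A)) ∧
      ∀ (res : ∀ A : C, K A → RightBousfield.CosimplicialResolution M A)
        (I J : MorphismProperty C), RightBousfield.IsCofibrantlyGeneratedBy M I J →
          RightBousfield.IsCofibrantlyGeneratedBy R (RightBousfield.Lambda K res ⊔ J) J := by
  have := hM.isLocallyPresentable
  obtain ⟨I₀, J₀, h₀⟩ := hM.exists_generators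
  have := h₀.smallObjectArgument_I
  have := h₀.smallObjectArgument_J
  have := isSmall_of_hasSmallObjectArgument I₀
  have := isSmall_of_hasSmallObjectArgument J₀
  have hres (A : C) : Nonempty (CosimplicialResolution M A) :=
    nonempty_cosimplicialResolution h₀.rlp_I A
  let res₀ (A : C) (_ : K A) : CosimplicialResolution M A := (hres A).some
  have := hasTwoOutOfThreeProperty_colocalEquivalences h₀.rlp_J hfib res₀
  have := hasSmallObjectArgument_Lambda_sup (J := J₀) res₀
  -- Neither `J.rlp` nor the colocal equivalences depend on the chosen generators or resolutions, so
  -- the one structure `R` serves every choice.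
  have hΛ (res : ∀ A : C, K A → CosimplicialResolution M A) (I J : MorphismProperty C)
      (h : IsCofibrantlyGeneratedBy M I J) :
      MorphismProperty.HasSmallObjectArgument.{w} (Lambda K res ⊔ J) ∧
        (Lambda K res ⊔ J).rlp = J₀.rlp ⊓ colocalEquivalences M K ∧ J.rlp = J₀.rlp := by
    have := h.smallObjectArgument_J
    have := isSmall_of_hasSmallObjectArgument J
    have e : J.rlp = J₀.rlp := h.rlp_J.trans h₀.rlp_J.symm
    exact ⟨hasSmallObjectArgument_Lambda_sup res,
      (rlp_Lambda_sup h.rlp_J hfib res).trans (by rw [e]), e⟩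
  have hfib' (X : C) : J₀.rlp (terminal.from X) := by
    rw [h₀.rlp_J]
    exact (hfib X).mem
  -- The left class here is that of the trivial cofibrations of `M`, and weak equivalences of `M`
  -- are colocal equivalences.
  have hJ₀ : J₀.rlp.llp ≤ colocalEquivalences M K := by
    rw [h₀.rlp_J, fibrations_llp]
    exact le_trans (fun _ _ _ hf ↦ hf.2)
      (weakEquivalences_le_colocalEquivalences h₀.rlp_J hfib res₀)
  obtain ⟨R, hR, hR'⟩ := exists_modelCategory (colocalEquivalences M K) (Lambda K res₀ ⊔ J₀) J₀
    (hΛ res₀ I₀ J₀ h₀).2.1 hJ₀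
  have key (res : ∀ A : C, K A → CosimplicialResolution M A) (I J : MorphismProperty C)
      (h : IsCofibrantlyGeneratedBy M I J) :
      IsCofibrantlyGeneratedBy R (Lambda K res ⊔ J) J := by
    obtain ⟨h₁, h₂, h₃⟩ := hΛ res I J h
    refine ⟨h₁, h.smallObjectArgument_J, ?_, h₃.trans hR'.symm⟩
    rw [h₂, ← hR, ← hR']
    rfl
  refine ⟨R, ⟨hR, hR'.trans h₀.rlp_J⟩, ⟨inferInstance, _, _, key res₀ I₀ J₀ h₀⟩,
    fun X ↦ ⟨?_⟩, fun A _ ↦ hres A, key⟩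
  have h := hfib' X
  rw [← hR'] at h
  exact h
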